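/- Let $n\ge 1$, $\beta,\gamma>0$, and let $\Omega\subset\mathbf R^n$ be a nonempty bounded star-shaped open set with $C^2$ boundary (star-shaped with respect to one of its points). Let $\Gamma:\mathbf R^n\setminus\Omega\to\mathbf R$ be a continuous function such that (i) $\Gamma$ is harmonic and positive on $\mathbf R^n\setminus\overline\Omega$; (ii) $\Gamma=0$ on $\partial\Omega$; (iii) $\nabla\Gamma(x)\neq0$ for all $x\in\mathbf R^n\setminus\overline\Omega$; (iv) $\Gamma$ is $C^1$ up to the boundary (its gradient extends continuously to $\mathbf R^n\setminus\Omega$) and for every $x\in\partial\Omega$ there is $t>0$ such that $\nabla\Gamma(x)=t\,\nu_\Omega(x)$, where $\nu_\Omega(x)$ is the outward unit normal vector of $\Omega$ at $x$. For $x\in\mathbf R^n\setminus\overline\Omega$ set $$\nu(x)=\frac{\nabla\Gamma(x)}{|\nabla\Gamma(x)|},\qquad \delta(x)=\frac{1}{1+\beta|\nabla\Gamma(x)|^{-1}\Gamma(x)},$$ and assume that $\mathrm{div}(\nu)$ is bounded on $\mathbf R^n\setminus\overline\Omega$. If $$\bigl(\beta^2-\beta\,\mathrm{div}(\nu)(x)\bigr)\,\delta(x)^2\le\gamma^2\qquad\text{for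 all }x\in\mathbf R^n\setminus\overline\Omega,$$ then $u=\mathbf 1_\Omega$ is calibrated, that is: $u\in SBV(\mathbf R^n)$, $u=1$ on $\Omega$, $0\le u\le1$, $u$ has compact support, and there is a Borel map $\phi=(\phi^x,\phi^t):(\mathbf R^n\setminus\Omega)\times\mathbf R\to\mathbf R^n\times\mathbf R$ which is bounded and approximately regular in $A=(\mathbf R^n\setminus\Omega)\times[0,1]$, divergence-free in the sense of distributions in $(\mathbf R^n\setminus\overline\Omega)\times\,]0,1[$, and satisfies (a) $\phi^t(x,t)\ge\frac14|\phi^x(x,t)|^2-\gamma^2\mathbf 1_{]0,1]}(t)$ for $\mathcal L^n$-a.e. $x\in\mathbf R^n\setminus\overline\Omega$ and every $t\in[0,1]$; (b) for $\mathcal H^{n-1}$-a.e. $x\in\mathbf R^n\setminus\Omega$ and all real $r<s$, the map $\phi^x(x,\cdot)$ is integrable on $[r,s]$ and $\left|\int_r^s\phi^x(x,t)\,dt\right|\le\beta(r^2+s^2)$; (a') $\phi^x(x,u(x))=2\nabla u(x)$ and $\phi^t(x,u(x))=|\nabla u(x)|^2-\gamma^2\mathbf 1_{]0,1]}(u(x))$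 for $\mathcal L^n$-a.e. $x\in\mathbf R^n\setminus\overline\Omega$, where $\nabla u$ is the approximate gradient; (b') $\int_{u^-}^{u^+}\phi^x(x,t)\,dt=\beta\left[(u^-)^2+(u^+)^2\right]\nu_u$ for $\mathcal H^{n-1}$-a.e. $x\in J_u$. Here $J_u$ is the set of jump points of $u$, $u^-<u^+$ are the one-sided approximate limits of $u$ at such a point, and the unit vector $\nu_u$ points from the side of $u^-$ to the side of $u^+$. Approximately regular in $A$ means that for every Lipschitz hypersurface $M\subset\mathbf R^n\times\mathbf R$, with unit normal $\nu_M$, and for $\mathcal H^n$-a.e. $p\in M\cap A$, the function $q\mapsto\phi(q)\cdot\nu_M(p)$ has at $p$, along $A$, the approximate limit $\phi(p)\cdot\nu_M(p)$. -/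

import Mathlib

open MeasureTheory Filter Topology Set
open scoped Gradient

namespace ThermalInsulation

/-- The space `ℝⁿ` with its Euclidean norm. -/
abbrev Sp (n : ℕ) : Type := EuclideanSpace ℝ (Fin n)

/-- The space `ℝⁿ × ℝ` with its Euclidean norm. -/
abbrev SpT (n : ℕ) : Type := WithLp 2 (Sp n × ℝ)

noncomputable section

/-! ### Domains of class `C²` -/

/-- `ρ` is a `C²` defining function of `Ω` near `x`: it is `C²` near `x`, has a non-zero gradient
at `x`, and `Ω = {ρ < 0}` near `x`. -/
structure IsDefiningFunctionAt {n : ℕ} (Ω : Set (Sp n)) (x : Sp n) (ρ : Sp n → ℝ) : Prop where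
  contDiffAt : ContDiffAt ℝ 2 ρ x
  gradient_ne_zero : ∇ ρ x ≠ 0
  eventually_mem_iff : ∀ᶠ y in 𝓝 x, (y ∈ Ω ↔ ρ y < 0)

/-- `Ω` is an open set with boundary of class `C²`, lying locally on one side of its boundary. -/
def IsC2Domain {n : ℕ} (Ω : Set (Sp n)) : Prop :=
  IsOpen Ω ∧ ∀ x ∈ frontier Ω, ∃ ρ : Sp n → ℝ, IsDefiningFunctionAt Ω x ρ

/-- `ν` is the outward unit normal vector of `Ω` at the boundary point `x`. -/
def IsOutwardUnitNormal {n : ℕ} (Ω : Set (Sp n)) (x ν : Sp n) : Prop :=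
  ∃ ρ : Sp n → ℝ, IsDefiningFunctionAt Ω x ρ ∧ ν = ‖∇ ρ x‖⁻¹ • ∇ ρ x

/-! ### The exterior potential -/

/-- The divergence of a vector field on `ℝⁿ`. -/
def divergence {n : ℕ} (F : Sp n → Sp n) (x : Sp n) : ℝ :=
  ∑ i : Fin n, (fderiv ℝ F x (EuclideanSpace.single i 1)) i

/-- `Γ` is an exterior potential of `Ω`. Only the values of `Γ` on the complement of `Ω` matter.
The last condition says that `Γ` is `C¹` up to the boundary (its gradient extends continuously, by
`g`) and that on the boundary this gradient is a positive multiple of the outward unit normal. -/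
structure IsExteriorPotential {n : ℕ} (Ω : Set (Sp n)) (Γ : Sp n → ℝ) : Prop where
  continuousOn : ContinuousOn Γ Ωᶜ
  harmonic : InnerProductSpace.HarmonicOnNhd Γ (closure Ω)ᶜ
  pos : ∀ x ∈ (closure Ω)ᶜ, 0 < Γ x
  eq_zero : ∀ x ∈ frontier Ω, Γ x = 0
  gradient_ne_zero : ∀ x ∈ (closure Ω)ᶜ, ∇ Γ x ≠ 0
  gradient_extends : ∃ g : Sp n → Sp n, ContinuousOn g Ωᶜ ∧
    (∀ x ∈ (closure Ω)ᶜ, g x = ∇ Γ x) ∧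
    ∀ x ∈ frontier Ω, ∀ ν : Sp n, IsOutwardUnitNormal Ω x ν → ∃ t : ℝ, 0 < t ∧ g x = t • ν

/-- The field `ν = ∇Γ / |∇Γ|`. -/
def nuField {n : ℕ} (Γ : Sp n → ℝ) (x : Sp n) : Sp n :=
  ‖∇ Γ x‖⁻¹ • ∇ Γ x

/-- The function `δ = 1 / (1 + β |∇Γ|⁻¹ Γ)`. -/
def deltaFun {n : ℕ} (β : ℝ) (Γ : Sp n → ℝ) (x : Sp n) : ℝ :=
  1 / (1 + β * ‖∇ Γ x‖⁻¹ * Γ x)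

/-! ### Jump points, approximate gradients and special functions of bounded variation -/

/-- `x` is a jump point of `u` with one-sided approximate limits `a < b`, where the unit vector `ν`
points from the side of the lower value `a = u⁻` to the side of the upper value `b = u⁺`. -/
structure IsJump {n : ℕ} (u : Sp n → ℝ) (x : Sp n) (a b : ℝ) (ν : Sp n) : Prop where
  lt : a < b
  norm_eq_one : ‖ν‖ = 1
  tendsto_upper : Tendsto
    (fun r : ℝ => ⨍ y in {y | y ∈ Metric.ball x r ∧ 0 < inner ℝ (y - x) ν}, |u y - b|)
    (𝓝[>] 0) (𝓝 0)
  tendsto_lower : Tendsto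
    (fun r : ℝ => ⨍ y in {y | y ∈ Metric.ball x r ∧ inner ℝ (y - x) ν < 0}, |u y - a|)
    (𝓝[>] 0) (𝓝 0)

/-- The jump set `J_u`. -/
def jumpSet {n : ℕ} (u : Sp n → ℝ) : Set (Sp n) :=
  {x | ∃ (a b : ℝ) (ν : Sp n), IsJump u x a b ν}

/-- `p` is the approximate gradient of `u` at `x`. For `u` in `SBV` it exists for almost every `x`
and it is the density of the absolutely continuous part of the distributional gradient. -/
def HasApproxGradientAt {n : ℕ} (u : Sp n → ℝ) (p x : Sp n) : Prop :=
  Tendsto (fun r : ℝ => ⨍ y in Metric.ball x r, |u y - u x - inner ℝ p (y - x)| / r)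
    (𝓝[>] 0) (𝓝 0)

/-- `u` belongs to `SBV(ℝⁿ)`: `u` is integrable and its distributional gradient is a finite vector
measure `Du = g dx + σ dm`, the sum of an absolutely continuous part and of a part concentrated on
the jump set `J_u` (there is no Cantor part). -/
def IsSBV {n : ℕ} (u : Sp n → ℝ) : Prop :=
  Integrable u volume ∧
  ∃ (g : Sp n → Sp n) (m : Measure (Sp n)) (σ : Sp n → Sp n),
    Integrable g volume ∧ IsFiniteMeasure m ∧ Integrable σ m ∧ m (jumpSet u)ᶜ = 0 ∧
    ∀ ψ : Sp n → ℝ, ContDiff ℝ (⊤ : ℕ∞) ψ → HasCompactSupport ψ →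
      ∫ x, u x • ∇ ψ x = -((∫ x, ψ x • g x) + ∫ x, ψ x • σ x ∂m)

/-! ### Approximately regular vector fields -/

section ApproxRegular

variable {F : Type*} [NormedAddCommGroup F] [InnerProductSpace ℝ F] [FiniteDimensional ℝ F]
  [MeasurableSpace F] [BorelSpace F]

/-- `M` is a Lipschitz hypersurface: near each of its points it is, in the direction of some unit
vector `v`, the graph of a Lipschitz function over the hyperplane orthogonal to `v`. -/
def IsLipschitzHypersurface (M : Set F) : Prop :=
  ∀ p ∈ M, ∃ (v : F) (f : F → ℝ) (K : NNReal), ‖v‖ = 1 ∧ LipschitzWith K f ∧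
    ∀ᶠ y in 𝓝 p, (y ∈ M ↔ inner ℝ y v = f (y - inner ℝ y v • v))

/-- `ν` is a unit normal vector of the hypersurface `M` at `p`. On a Lipschitz hypersurface there
is one, unique up to its sign, at almost every point. -/
def IsUnitNormal (M : Set F) (p ν : F) : Prop :=
  ‖ν‖ = 1 ∧ (fun y => inner ℝ (y - p) ν) =o[𝓝[M] p] (fun y => y - p)

/-- `h` has the approximate limit `l` at `p` along the set `A`. -/
def ApproxTendsto (A : Set F) (h : F → ℝ) (p : F) (l : ℝ) : Prop :=
  ∀ ε : ℝ, 0 < ε → Tendsto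
    (fun r : ℝ => volume {q | q ∈ A ∩ Metric.ball p r ∧ ε < |h q - l|} /
      volume (A ∩ Metric.ball p r)) (𝓝[>] 0) (𝓝 0)

/-- `φ` is approximately regular on `A`: for every Lipschitz hypersurface `M`, the component of `φ`
along the normal of `M` at `p` is approximately continuous at `p`, for almost every `p ∈ M ∩ A` with
respect to the Hausdorff measure of dimension `dim F - 1`. -/
def IsApproxRegularOn (φ : F → F) (A : Set F) : Prop :=
  ∀ M : Set F, IsLipschitzHypersurface M →
    ∀ᵐ p ∂(Measure.hausdorffMeasure ((Module.finrank ℝ F : ℝ) - 1) : Measure F), p ∈ M ∩ A →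
      ∀ ν : F, IsUnitNormal M p ν →
        ApproxTendsto A (fun q => inner ℝ (φ q) ν) p (inner ℝ (φ p) ν)

/-- `φ` is divergence-free in the open set `U`, in the sense of distributions. -/
def IsDivergenceFreeOn (φ : F → F) (U : Set F) : Prop :=
  ∀ ψ : F → ℝ, ContDiff ℝ (⊤ : ℕ∞) ψ → HasCompactSupport ψ → tsupport ψ ⊆ U →
    ∫ p in U, inner ℝ (φ p) (∇ ψ p) = 0

end ApproxRegular

/-! ### Calibrations -/

/-- The point `(x, t)` of `ℝⁿ × ℝ`. -/
def pt {n : ℕ} (x : Sp n) (t : ℝ) : SpT n := WithLp.toLp 2 (x, t)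

/-- The term `γ² 1_{]0,1]}(t)`. -/
def volumeTerm (γ t : ℝ) : ℝ := (Ioc (0 : ℝ) 1).indicator (fun _ => γ ^ 2) t

/-- The Hausdorff measure of dimension `n - 1` on `ℝⁿ`. -/
def hausdorffCodimOne (n : ℕ) : Measure (Sp n) := Measure.hausdorffMeasure ((n : ℝ) - 1)

/-- `φ = (φˣ, φᵗ)` is a calibration for `u`. Only its values on `(ℝⁿ ∖ Ω) × ℝ` matter. -/
structure IsCalibration {n : ℕ} (β γ : ℝ) (Ω : Set (Sp n)) (u : Sp n → ℝ)
    (φ : SpT n → SpT n) : Prop where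
  /-- `φ` is a Borel map on `(ℝⁿ ∖ Ω) × ℝ`. -/
  borel : Measurable (fun p : {p : SpT n // p.fst ∉ Ω} => φ p)
  bounded : ∃ C : ℝ, ∀ x ∉ Ω, ∀ t ∈ Icc (0 : ℝ) 1, ‖φ (pt x t)‖ ≤ C
  approxRegular : IsApproxRegularOn φ {p | p.fst ∉ Ω ∧ p.snd ∈ Icc (0 : ℝ) 1}
  divergenceFree : IsDivergenceFreeOn φ {p | p.fst ∉ closure Ω ∧ p.snd ∈ Ioo (0 : ℝ) 1}
  /-- Lower bound of the vertical component. -/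
  lower_bound : ∀ᵐ x : Sp n, x ∉ closure Ω → ∀ t ∈ Icc (0 : ℝ) 1,
    1 / 4 * ‖(φ (pt x t)).fst‖ ^ 2 - volumeTerm γ t ≤ (φ (pt x t)).snd
  /-- Bound of the horizontal flux between two levels. -/
  flux_bound : ∀ᵐ x ∂(hausdorffCodimOne n), x ∉ Ω → ∀ r s : ℝ, r < s →
    IntervalIntegrable (fun t => (φ (pt x t)).fst) volume r s ∧
    ‖∫ t in r..s, (φ (pt x t)).fst‖ ≤ β * (r ^ 2 + s ^ 2)
  /-- Values of the field on the graph of `u`. -/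
  eq_on_graph : ∀ᵐ x : Sp n, x ∉ closure Ω → ∃ p : Sp n, HasApproxGradientAt u p x ∧
    (φ (pt x (u x))).fst = (2 : ℝ) • p ∧
    (φ (pt x (u x))).snd = ‖p‖ ^ 2 - volumeTerm γ (u x)
  /-- Horizontal flux across the jump of `u`. -/
  eq_on_jump : ∀ᵐ x ∂(hausdorffCodimOne n), ∀ (a b : ℝ) (ν : Sp n), IsJump u x a b ν →
    ∫ t in a..b, (φ (pt x t)).fst = (β * (a ^ 2 + b ^ 2)) • ν

/-- `u` is an admissible competitor: `u ∈ SBV(ℝⁿ)` has compact support, `0 ≤ u ≤ 1`, and `u = 1` on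
`Ω` (almost everywhere, as elements of `SBV` are classes of functions). -/
structure IsCompetitor {n : ℕ} (Ω : Set (Sp n)) (u : Sp n → ℝ) : Prop where
  sbv : IsSBV u
  eq_one : ∀ᵐ x : Sp n, x ∈ Ω → u x = 1
  mem_Icc : ∀ᵐ x : Sp n, u x ∈ Icc (0 : ℝ) 1
  compactSupport : ∃ K : Set (Sp n), IsCompact K ∧ ∀ᵐ x : Sp n, x ∉ K → u x = 0

/-- `u` is calibrated: it is an admissible competitor and it has a calibration. -/
def IsCalibrated {n : ℕ} (β γ : ℝ) (Ω : Set (Sp n)) (u : Sp n → ℝ) : Prop :=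
  IsCompetitor Ω u ∧ ∃ φ : SpT n → SpT n, IsCalibration β γ Ω u φ

end

end ThermalInsulation

/-!
The characteristic function of `Ω` is calibrated by an explicit field. Write `ν = ∇Γ / |∇Γ|`,
`q = |∇Γ| / Γ`, so that `δ = q / (β + q)`, and put
`φˣ(x, t) = -2 min (β t, (1 - t) q(x)) ν(x)` for `t ∈ [0, 1]`. Below the level `δ(x)` this is the
field `-2 β t ν`, which saturates the flux bound; above it, it is the field `2 ∇v` tangent to the
family of harmonic functions `v = 1 - λ Γ`. The two agree at `t = δ(x)`.

*Divergence.* Let `w(q, t) = ∫₀ᵗ 2 min (β s, (1 - s) q) ds = β t² - (((β + q) t - q)⁺)² / (β + q)`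
(`profile`). The vector field `W = w ν` is of class `C¹`, even across the graph of `δ`, so that
`φ = (-∂ₜ W, div W)` is divergence-free by the symmetry of second derivatives of test functions
(`integral_fderiv_mul_fderiv_sub_eq_zero`). Since `Γ` is harmonic, `∇q · ν = -(q div ν + q²)`
(`fderiv_slope_nuField`), whence `φᵗ = β t² div ν` below `δ` and
`φᵗ = (1 - t)² q² - (β² - β div ν) δ²` above. The hypothesis on `δ` is then exactly the lower bound
of `φᵗ` by `|φˣ|² / 4 - γ²` (`sq_speed_le_verticalSpeed`).

*Approximate regularity.* Off the boundary `φ` is continuous. On the boundary cylinder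
`∂Ω × [0, 1[` only `φˣ` is continuous, because `q → ∞` there; this suffices at points where the
normal of the hypersurface is horizontal. The other points of the hypersurface on the cylinder form
countably many Lipschitz graphs over pieces of `∂Ω`, which is null for the `n`-dimensional
Hausdorff measure (`hausdorffMeasure_nonhorizontal_eq_zero`).

*The competitor.* Blowing up at a boundary point shows that `∂Ω` is a null set consisting of jump
points, with jump from `0` to `1` along the inward normal (`IsDefiningFunctionAt.hasBlowUp`,
`IsDefiningFunctionAt.eq_of_isJump`). That the distributional gradient of `1_Ω` is a measure on `∂Ω`
(`exists_boundary_measure`) is proved without boundary charts: the measures with density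
`χ_k'(Γ) |∇Γ|²`, where the smooth step functions `χ_k` converge to `1` on `]0, ∞[`, have bounded
masses since `Γ` is harmonic, and any weak limit of them carries the gradient of `1_Ω`, with density
`-∇Γ / |∇Γ|²`.
-/

namespace ThermalInsulation

noncomputable section

/-! ### Integration by parts -/

section IntegrationByParts

/-- A function continuous on an open set, multiplied by a continuous function supported there,
is continuous. -/
lemma continuous_mul_of_tsupport_subset {E : Type*} [TopologicalSpace E] {V : Set E}
    (hV : IsOpen V) {f h : E → ℝ} (hf : ContinuousOn f V) (hh : Continuous h) (hsupp : tsupport h ⊆ V) :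
    Continuous fun x => f x * h x := by
  rw [continuous_iff_continuousAt]
  intro x
  by_cases hx : x ∈ tsupport h
  · exact (hf.continuousAt (hV.mem_nhds (hsupp hx))).mul hh.continuousAt
  · have h0 : ∀ᶠ y in 𝓝 x, f y * h y = 0 := by
      filter_upwards [(isClosed_tsupport h).isOpen_compl.mem_nhds hx] with y hy
      rw [image_eq_zero_of_notMem_tsupport hy, mul_zero]
    exact (continuousAt_const (y := (0 : ℝ))).congr (h0.mono fun y hy => hy.symm)

variable {E : Type*} [NormedAddCommGroup E] [NormedSpace ℝ E] [FiniteDimensional ℝ E]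
  [MeasurableSpace E] [BorelSpace E] {μ : Measure E} [μ.IsAddHaarMeasure]

/-- Integration by parts of a `C¹` function on an open set against a compactly supported `C¹`
function. -/
lemma integral_mul_fderiv_eq_neg_of_tsupport_subset {V : Set E} (hV : IsOpen V) {f ζ : E → ℝ}
    (hf : ContDiffOn ℝ 1 f V) (hζ : ContDiff ℝ 1 ζ) (hc : HasCompactSupport ζ)
    (hsupp : tsupport ζ ⊆ V) (v : E) :
    ∫ x, f x * fderiv ℝ ζ x v ∂μ = -∫ x, fderiv ℝ f x v * ζ x ∂μ := by
  have hdf : ContinuousOn (fun x => fderiv ℝ f x v) V :=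
    (hf.continuousOn_fderiv_of_isOpen hV le_rfl).clm_apply continuousOn_const
  have hdζ : Continuous fun x => fderiv ℝ ζ x v :=
    (hζ.continuous_fderiv (by norm_num)).clm_apply continuous_const
  refine integral_mul_fderiv_eq_neg_fderiv_mul_of_integrable ?_ ?_ ?_ ?_ ?_
  · exact (continuous_mul_of_tsupport_subset hV hdf hζ.continuous
      hsupp).integrable_of_hasCompactSupport hc.mul_left
  · refine (continuous_mul_of_tsupport_subset hV hf.continuousOn hdζ
      ?_).integrable_of_hasCompactSupport (hc.fderiv_apply ℝ v).mul_left
    exact (tsupport_fderiv_apply_subset ℝ v).trans hsupp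
  · exact (continuous_mul_of_tsupport_subset hV hf.continuousOn hζ.continuous
      hsupp).integrable_of_hasCompactSupport hc.mul_left
  · intro x hx
    exact (hf.contDiffAt (hV.mem_nhds (hsupp hx))).differentiableAt (by norm_num)
  · exact fun x _ => (hζ.differentiable (by norm_num)) x

/-- The derivative of a compactly supported `C¹` function has zero mean. -/
lemma integral_fderiv_eq_zero_of_hasCompactSupport {ζ : E → ℝ} (hζ : ContDiff ℝ 1 ζ)
    (hc : HasCompactSupport ζ) (v : E) : ∫ x, fderiv ℝ ζ x v ∂μ = 0 := by
  have := integral_mul_fderiv_eq_neg_of_tsupport_subset (μ := μ) isOpen_univ (f := fun _ => (1 : ℝ))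
    contDiffOn_const hζ hc (subset_univ _) v
  simpa using this

/-- The mixed second derivatives of a test function cancel: `∂ₐf ∂_bψ - ∂_bf ∂ₐψ` has zero mean. -/
lemma integral_fderiv_mul_fderiv_sub_eq_zero {V : Set E} (hV : IsOpen V) {f ψ : E → ℝ}
    (hf : ContDiffOn ℝ 1 f V) (hψ : ContDiff ℝ 2 ψ) (hc : HasCompactSupport ψ)
    (hsupp : tsupport ψ ⊆ V) (a b : E) :
    Integrable (fun x => fderiv ℝ f x a * fderiv ℝ ψ x b) μ ∧
    ∫ x, (fderiv ℝ f x a * fderiv ℝ ψ x b - fderiv ℝ f x b * fderiv ℝ ψ x a) ∂μ = 0 := by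
  have hd (v : E) : ContDiff ℝ 1 fun x => fderiv ℝ ψ x v :=
    (hψ.fderiv_right (m := 1) (by norm_num)).clm_apply contDiff_const
  have hs (v : E) : tsupport (fun x => fderiv ℝ ψ x v) ⊆ V :=
    (tsupport_fderiv_apply_subset ℝ v).trans hsupp
  have hint (v w : E) : Integrable (fun x => fderiv ℝ f x v * fderiv ℝ ψ x w) μ :=
    (continuous_mul_of_tsupport_subset hV
      ((hf.continuousOn_fderiv_of_isOpen hV le_rfl).clm_apply continuousOn_const)
      (hd w).continuous (hs w)).integrable_of_hasCompactSupport (hc.fderiv_apply ℝ w).mul_left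
  have key (v w : E) : ∫ x, fderiv ℝ f x v * fderiv ℝ ψ x w ∂μ =
      -∫ x, f x * fderiv ℝ (fun y => fderiv ℝ ψ y w) x v ∂μ := by
    rw [integral_mul_fderiv_eq_neg_of_tsupport_subset hV hf (hd w) (hc.fderiv_apply ℝ w) (hs w) v,
      neg_neg]
  refine ⟨hint a b, ?_⟩
  rw [integral_sub (hint a b) (hint b a), key, key, sub_eq_zero]
  congr 2
  ext x
  have hdd : DifferentiableAt ℝ (fderiv ℝ ψ) x :=
    (hψ.fderiv_right (m := 1) (by norm_num)).differentiable (by norm_num) x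
  have hap (v w : E) : fderiv ℝ (fun y => fderiv ℝ ψ y w) x v = fderiv ℝ (fderiv ℝ ψ) x v w := by
    rw [fderiv_clm_apply hdd (differentiableAt_const w)]
    simp
  rw [hap, hap]
  congr 1
  exact (hψ.contDiffAt.isSymmSndFDerivAt (by simp)).eq a b

end IntegrationByParts

/-! ### The potential -/

section Potential

variable {n : ℕ} {Ω : Set (Sp n)} {Γ : Sp n → ℝ}

lemma gradient_apply_eq_fderiv (f : Sp n → ℝ) (x : Sp n) (i : Fin n) :
    (∇ f x) i = fderiv ℝ f x (EuclideanSpace.single i 1) := by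
  have h := EuclideanSpace.inner_single_right (𝕜 := ℝ) i (1 : ℝ) (∇ f x)
  rw [inner_gradient_left] at h
  simpa using h.symm

lemma isOpen_compl_closure (Ω : Set (Sp n)) : IsOpen (closure Ω)ᶜ := isClosed_closure.isOpen_compl

lemma IsExteriorPotential.contDiffOn (h : IsExteriorPotential Ω Γ) :
    ContDiffOn ℝ 2 Γ (closure Ω)ᶜ := h.harmonic.contDiffOn

lemma IsExteriorPotential.contDiffOn_gradient (h : IsExteriorPotential Ω Γ) :
    ContDiffOn ℝ 1 (∇ Γ) (closure Ω)ᶜ :=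
  (InnerProductSpace.toDual ℝ (Sp n)).symm.contDiff.comp_contDiffOn
    (h.contDiffOn.fderiv_of_isOpen (isOpen_compl_closure Ω) (by norm_num))

lemma IsExteriorPotential.contDiffOn_partial (h : IsExteriorPotential Ω Γ) (v : Sp n) :
    ContDiffOn ℝ 1 (fun x => fderiv ℝ Γ x v) (closure Ω)ᶜ :=
  (h.contDiffOn.fderiv_of_isOpen (isOpen_compl_closure Ω) (by norm_num)).clm_apply contDiffOn_const

lemma IsExteriorPotential.sum_partial_partial_eq_zero (h : IsExteriorPotential Ω Γ) {x : Sp n}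
    (hx : x ∈ (closure Ω)ᶜ) :
    ∑ i : Fin n, fderiv ℝ (fun y => fderiv ℝ Γ y (EuclideanSpace.single i 1)) x
      (EuclideanSpace.single i 1) = 0 := by
  have h0 := (h.harmonic x hx).2.self_of_nhds
  rw [InnerProductSpace.laplacian_eq_iteratedFDeriv_orthonormalBasis Γ
    (EuclideanSpace.basisFun (Fin n) ℝ)] at h0
  simp only [Pi.zero_apply] at h0
  rw [← h0]
  refine Finset.sum_congr rfl fun i _ => ?_
  have hd : DifferentiableAt ℝ (fderiv ℝ Γ) x :=
    ((h.contDiffOn.fderiv_of_isOpen (isOpen_compl_closure Ω) (m := 1) (by norm_num)).contDiffAt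
      ((isOpen_compl_closure Ω).mem_nhds hx)).differentiableAt (by norm_num)
  rw [fderiv_clm_apply hd (differentiableAt_const _), iteratedFDeriv_two_apply]
  simp

lemma IsExteriorPotential.divergence_gradient (h : IsExteriorPotential Ω Γ) {x : Sp n}
    (hx : x ∈ (closure Ω)ᶜ) : divergence (∇ Γ) x = 0 := by
  rw [← h.sum_partial_partial_eq_zero hx, divergence]
  refine Finset.sum_congr rfl fun i _ => ?_
  have hd : DifferentiableAt ℝ (∇ Γ) x :=
    (h.contDiffOn_gradient.contDiffAt ((isOpen_compl_closure Ω).mem_nhds hx)).differentiableAt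
      (by norm_num)
  have h1 : (fun y => fderiv ℝ Γ y (EuclideanSpace.single i 1)) =
      fun y => EuclideanSpace.proj (𝕜 := ℝ) i (∇ Γ y) := by
    ext y
    simp [gradient_apply_eq_fderiv]
  have h2 : HasFDerivAt (fun y => EuclideanSpace.proj (𝕜 := ℝ) i (∇ Γ y)) _ x :=
    (EuclideanSpace.proj (𝕜 := ℝ) i).hasFDerivAt.comp x hd.hasFDerivAt
  rw [h1, h2.fderiv]
  simp

end Potential

/-! ### The surface measure of the boundary, as a limit of measures carried by level strips -/

section SurfaceMeasure

variable {n : ℕ} {Ω : Set (Sp n)} {Γ : Sp n → ℝ} {g : Sp n → Sp n}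

/-- A smooth cutoff of the exterior domain: it vanishes on `closure Ω` and where
`Γ ≤ 1 / (k + 1)`, and it is `1` where `Γ ≥ 2 / (k + 1)`. -/
def levelCutoff (Ω : Set (Sp n)) (Γ : Sp n → ℝ) (k : ℕ) : Sp n → ℝ :=
  (closure Ω)ᶜ.indicator fun x => Real.smoothTransition ((k + 1) * Γ x - 1)

lemma abs_levelCutoff_le_one (k : ℕ) (x : Sp n) : |levelCutoff Ω Γ k x| ≤ 1 := by
  unfold levelCutoff indicator
  split_ifs
  · rw [abs_of_nonneg (Real.smoothTransition.nonneg _)]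
    exact Real.smoothTransition.le_one _
  · simp

lemma levelCutoff_eventuallyEq_zero (hΩ : IsOpen Ω) (h : IsExteriorPotential Ω Γ) (k : ℕ)
    {x : Sp n} (hx : x ∈ closure Ω) : levelCutoff Ω Γ k =ᶠ[𝓝 x] 0 := by
  by_cases hxΩ : x ∈ Ω
  · filter_upwards [hΩ.mem_nhds hxΩ] with y hy
    simp [levelCutoff, subset_closure hy]
  · have hfr : x ∈ frontier Ω := by rw [hΩ.frontier_eq]; exact ⟨hx, hxΩ⟩
    have hcont : Tendsto Γ (𝓝[Ωᶜ] x) (𝓝 0) := by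
      have := h.continuousOn x hxΩ
      rwa [ContinuousWithinAt, h.eq_zero x hfr] at this
    have hk : (0 : ℝ) < 1 / (k + 1) := by positivity
    have hev := eventually_nhdsWithin_iff.1 (hcont.eventually (gt_mem_nhds hk))
    filter_upwards [hev] with y hy
    unfold levelCutoff indicator
    split_ifs with hyU
    · have h1 := hy fun hyΩ => hyU (subset_closure hyΩ)
      rw [lt_div_iff₀ (by positivity)] at h1
      exact Real.smoothTransition.zero_of_nonpos (by linarith)
    · rfl

lemma levelCutoff_eventuallyEq (k : ℕ) {x : Sp n} (hx : x ∈ (closure Ω)ᶜ) :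
    levelCutoff Ω Γ k =ᶠ[𝓝 x] fun y => Real.smoothTransition ((k + 1) * Γ y - 1) := by
  filter_upwards [(isOpen_compl_closure Ω).mem_nhds hx] with y hy
  rw [levelCutoff, indicator_of_mem hy]

lemma contDiff_levelCutoff_mul (hΩ : IsOpen Ω) (h : IsExteriorPotential Ω Γ) (k : ℕ)
    {f : Sp n → ℝ} (hf : ContDiffOn ℝ 1 f (closure Ω)ᶜ) :
    ContDiff ℝ 1 fun x => levelCutoff Ω Γ k x * f x := by
  rw [contDiff_iff_contDiffAt]
  intro x
  by_cases hx : x ∈ closure Ω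
  · refine (contDiffAt_const (c := (0 : ℝ))).congr_of_eventuallyEq ?_
    filter_upwards [levelCutoff_eventuallyEq_zero hΩ h k hx] with y hy
    simp [hy]
  · have hU := (isOpen_compl_closure Ω).mem_nhds (show x ∈ (closure Ω)ᶜ from hx)
    refine ContDiffAt.mul (ContDiffAt.congr_of_eventuallyEq ?_ (levelCutoff_eventuallyEq k hx))
      (hf.contDiffAt hU)
    have hΓ : ContDiffAt ℝ 1 Γ x := (h.contDiffOn.contDiffAt hU).of_le (by norm_num)
    exact (Real.smoothTransition.contDiff (n := 1)).contDiffAt.comp x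
      ((contDiffAt_const.mul hΓ).sub contDiffAt_const)

lemma contDiff_levelCutoff (hΩ : IsOpen Ω) (h : IsExteriorPotential Ω Γ) (k : ℕ) :
    ContDiff ℝ 1 (levelCutoff Ω Γ k) := by
  simpa using contDiff_levelCutoff_mul hΩ h k (contDiffOn_const (c := (1 : ℝ)))

/-- The gradient of the cutoff is a nonnegative multiple of `∇Γ`, and vanishes off a level strip. -/
lemma fderiv_levelCutoff (hΩ : IsOpen Ω) (h : IsExteriorPotential Ω Γ) (k : ℕ) (x v : Sp n) :
    fderiv ℝ (levelCutoff Ω Γ k) x v = (closure Ω)ᶜ.indicator (fun x =>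
      deriv Real.smoothTransition ((k + 1) * Γ x - 1) * (k + 1)) x * fderiv ℝ Γ x v := by
  by_cases hx : x ∈ closure Ω
  · rw [(levelCutoff_eventuallyEq_zero hΩ h k hx).fderiv_eq,
      indicator_of_notMem (notMem_compl_iff.2 hx)]
    simp
  · have hU := (isOpen_compl_closure Ω).mem_nhds (show x ∈ (closure Ω)ᶜ from hx)
    have hΓ : HasFDerivAt Γ (fderiv ℝ Γ x) x :=
      ((h.contDiffOn.contDiffAt hU).differentiableAt (by norm_num)).hasFDerivAt
    have hT : HasDerivAt Real.smoothTransition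
        (deriv Real.smoothTransition ((k + 1) * Γ x - 1)) ((k + 1) * Γ x - 1) :=
      ((Real.smoothTransition.contDiff (n := 1)).differentiable (by norm_num) _).hasDerivAt
    have h1 := hT.comp_hasFDerivAt x ((hΓ.const_mul ((k : ℝ) + 1)).sub_const 1)
    have h2 : fderiv ℝ (levelCutoff Ω Γ k) x = _ :=
      (levelCutoff_eventuallyEq k hx).fderiv_eq.trans h1.fderiv
    rw [h2, indicator_of_mem (show x ∈ (closure Ω)ᶜ from hx)]
    simp
    ring

lemma deriv_smoothTransition_eq_zero {s : ℝ} (hs : 1 < s) : deriv Real.smoothTransition s = 0 := by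
  have : Real.smoothTransition =ᶠ[𝓝 s] fun _ => (1 : ℝ) := by
    filter_upwards [lt_mem_nhds hs] with y hy using Real.smoothTransition.one_of_one_le hy.le
  rw [this.deriv_eq, deriv_const]

lemma tendsto_levelCutoff (h : IsExteriorPotential Ω Γ) (x : Sp n) :
    Tendsto (fun k => levelCutoff Ω Γ k x) atTop (𝓝 ((closure Ω)ᶜ.indicator (fun _ => 1) x)) := by
  by_cases hx : x ∈ (closure Ω)ᶜ
  · have hpos := h.pos x hx
    have ht : Tendsto (fun k : ℕ => ((k : ℝ) + 1) * Γ x - 1) atTop atTop :=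
      tendsto_atTop_add_const_right _ _ ((tendsto_atTop_add_const_right _ _
        tendsto_natCast_atTop_atTop).atTop_mul_const hpos)
    refine tendsto_const_nhds.congr' ?_
    filter_upwards [ht.eventually_ge_atTop 1] with k hk
    rw [levelCutoff, indicator_of_mem hx, indicator_of_mem hx,
      Real.smoothTransition.one_of_one_le hk]
  · simp [levelCutoff, indicator_of_notMem hx]

/-- The density of the `k`-th strip measure, an approximation of `|∇Γ|` times the surface measure
of the boundary. The cutoff `η` is `1` near `closure Ω`. -/
def stripDensity (Ω : Set (Sp n)) (Γ η : Sp n → ℝ) (k : ℕ) (x : Sp n) : ℝ :=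
  (∑ i : Fin n, fderiv ℝ (levelCutoff Ω Γ k) x (EuclideanSpace.single i 1) *
    fderiv ℝ Γ x (EuclideanSpace.single i 1)) * η x

lemma sum_fderiv_sq (f : Sp n → ℝ) (x : Sp n) :
    ∑ i : Fin n, fderiv ℝ f x (EuclideanSpace.single i 1) ^ 2 = ‖∇ f x‖ ^ 2 := by
  rw [EuclideanSpace.norm_sq_eq]
  simp [gradient_apply_eq_fderiv]

lemma stripDensity_eq (hΩ : IsOpen Ω) (h : IsExteriorPotential Ω Γ) (η : Sp n → ℝ) (k : ℕ)
    (x : Sp n) : stripDensity Ω Γ η k x = (closure Ω)ᶜ.indicator (fun x =>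
      deriv Real.smoothTransition ((k + 1) * Γ x - 1) * (k + 1)) x * ‖∇ Γ x‖ ^ 2 * η x := by
  simp only [stripDensity, fderiv_levelCutoff hΩ h, ← sum_fderiv_sq, Finset.mul_sum]
  congr 1
  exact Finset.sum_congr rfl fun i _ => by ring

lemma stripDensity_nonneg (hΩ : IsOpen Ω) (h : IsExteriorPotential Ω Γ) {η : Sp n → ℝ}
    (hη : ∀ x, 0 ≤ η x) (k : ℕ) (x : Sp n) : 0 ≤ stripDensity Ω Γ η k x := by
  rw [stripDensity_eq hΩ h]
  refine mul_nonneg (mul_nonneg (indicator_nonneg (fun y _ => ?_) x) (by positivity)) (hη x)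
  exact mul_nonneg Real.smoothTransition.monotone.deriv_nonneg (by positivity)

lemma continuous_stripDensity (hΩ : IsOpen Ω) (h : IsExteriorPotential Ω Γ) {η : Sp n → ℝ}
    (hη : Continuous η) (k : ℕ) : Continuous (stripDensity Ω Γ η k) := by
  refine Continuous.mul (continuous_finsetSum _ fun i _ => ?_) hη
  rw [continuous_iff_continuousAt]
  intro x
  by_cases hx : x ∈ closure Ω
  · refine (continuousAt_const (y := (0 : ℝ))).congr ?_
    filter_upwards [(levelCutoff_eventuallyEq_zero hΩ h k hx).fderiv (𝕜 := ℝ)] with y hy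
    rw [hy]
    simp
  · have hU := (isOpen_compl_closure Ω).mem_nhds (show x ∈ (closure Ω)ᶜ from hx)
    exact (((contDiff_levelCutoff hΩ h k).continuous_fderiv (by norm_num)).clm_apply
      continuous_const).continuousAt.mul ((h.contDiffOn_partial _).continuousOn.continuousAt hU)

/-- The strip measures have bounded mass. As `Γ` is harmonic, the mass is
`-∫ F ∇Γ · ∇η`, where `F` is the level cutoff, which does not see the derivative of `F`. -/
lemma exists_integral_stripDensity_le (hΩ : IsOpen Ω) (h : IsExteriorPotential Ω Γ)
    (hg : ContinuousOn g Ωᶜ) (hgU : ∀ x ∈ (closure Ω)ᶜ, g x = ∇ Γ x)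
    {η : Sp n → ℝ} (hη : ContDiff ℝ 1 η) (hηc : HasCompactSupport η) :
    ∃ C : ℝ, ∀ k, ∫ x, stripDensity Ω Γ η k x ≤ C := by
  set e : Fin n → Sp n := fun i => EuclideanSpace.single i 1 with he
  obtain ⟨B, hB'⟩ : ∃ B, ∀ x ∈ tsupport η ∩ Ωᶜ, ‖g x‖ ≤ B :=
    (hηc.isCompact.inter_right hΩ.isClosed_compl).exists_bound_of_continuousOn
      (hg.mono inter_subset_right)
  have hB : ∀ x ∈ tsupport η ∩ Ωᶜ, ‖g x‖ ≤ max B 0 := fun x hx => (hB' x hx).trans (le_max_left _ _)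
  have hdη (i : Fin n) : Continuous fun x => fderiv ℝ η x (e i) :=
    (hη.continuous_fderiv (by norm_num)).clm_apply continuous_const
  have hF (k : ℕ) (i : Fin n) := contDiff_levelCutoff_mul hΩ h k (h.contDiffOn_partial (e i))
  refine ⟨∑ i, ∫ x, max B 0 * ‖fderiv ℝ η x (e i)‖, fun k => ?_⟩
  have hsum : ∫ x, stripDensity Ω Γ η k x =
      -∑ i, ∫ x, levelCutoff Ω Γ k x * fderiv ℝ Γ x (e i) * fderiv ℝ η x (e i) := by
    have h1 (i : Fin n) := integral_mul_fderiv_eq_neg_of_tsupport_subset (μ := volume) isOpen_univ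
      (hF k i).contDiffOn hη hηc (subset_univ _) (e i)
    simp only [h1, Finset.sum_neg_distrib, neg_neg]
    rw [← integral_finsetSum]
    · refine integral_congr_ae (Eventually.of_forall fun x => ?_)
      simp only [stripDensity]
      rw [← Finset.sum_mul]
      by_cases hx : x ∈ closure Ω
      · have h0 := levelCutoff_eventuallyEq_zero hΩ h k hx
        have h2 (i : Fin n) :
            fderiv ℝ (fun y => levelCutoff Ω Γ k y * fderiv ℝ Γ y (e i)) x = 0 := by
          have : (fun y => levelCutoff Ω Γ k y * fderiv ℝ Γ y (e i)) =ᶠ[𝓝 x] fun _ => (0 : ℝ) := by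
            filter_upwards [h0] with y hy
            simp [hy]
          rw [this.fderiv_eq]
          simp
        simp [h2, h0.fderiv_eq]
      · have hU := (isOpen_compl_closure Ω).mem_nhds (show x ∈ (closure Ω)ᶜ from hx)
        have h2 (i : Fin n) : fderiv ℝ (fun y => levelCutoff Ω Γ k y * fderiv ℝ Γ y (e i)) x (e i) =
            fderiv ℝ (levelCutoff Ω Γ k) x (e i) * fderiv ℝ Γ x (e i) +
              levelCutoff Ω Γ k x * fderiv ℝ (fun y => fderiv ℝ Γ y (e i)) x (e i) := by
          rw [fderiv_fun_mul ((contDiff_levelCutoff hΩ h k).differentiable (by norm_num) x)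
            (((h.contDiffOn_partial (e i)).contDiffAt hU).differentiableAt (by norm_num))]
          simp
          ring
        rw [Finset.sum_congr rfl fun i _ => h2 i, Finset.sum_add_distrib, ← Finset.mul_sum,
          h.sum_partial_partial_eq_zero (show x ∈ (closure Ω)ᶜ from hx), mul_zero, add_zero]
    · intro i _
      exact ((((hF k i).continuous_fderiv (by norm_num)).clm_apply
        continuous_const).mul hη.continuous).integrable_of_hasCompactSupport hηc.mul_left
  rw [hsum, ← Finset.sum_neg_distrib]
  refine Finset.sum_le_sum fun i _ => ?_
  rw [← integral_neg]
  refine integral_mono ?_ ?_ fun x => ?_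
  · exact (((hF k i).continuous.mul (hdη i)).integrable_of_hasCompactSupport
      (hηc.fderiv_apply ℝ (e i)).mul_left).neg
  · exact ((continuous_const.mul (hdη i).norm).integrable_of_hasCompactSupport
      (hηc.fderiv_apply ℝ (e i)).norm.mul_left)
  · refine (neg_le_abs _).trans ?_
    rw [abs_mul, Real.norm_eq_abs]
    by_cases hx : x ∈ tsupport η
    · refine mul_le_mul_of_nonneg_right ?_ (abs_nonneg _)
      have hB0 : x ∉ closure Ω → |fderiv ℝ Γ x (e i)| ≤ max B 0 := fun hxU => by
        refine le_trans ?_ (hB x ⟨hx, fun hxΩ => hxU (subset_closure hxΩ)⟩)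
        rw [hgU x hxU, ← inner_gradient_left]
        simpa [he] using abs_real_inner_le_norm (∇ Γ x) (e i)
      by_cases hxU : x ∈ closure Ω
      · rw [(levelCutoff_eventuallyEq_zero hΩ h k hxU).self_of_nhds]
        simp
      · rw [abs_mul]
        exact (mul_le_of_le_one_left (abs_nonneg _) (abs_levelCutoff_le_one k x)).trans (hB0 hxU)
    · have : fderiv ℝ η x (e i) = 0 := by
        rw [image_eq_zero_of_notMem_tsupport fun h' => hx (tsupport_fderiv_subset ℝ h')]
        rfl
      simp [this]

/-- Weak limits of measures carried by a fixed compact set, with bounded masses. -/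
lemma exists_ultrafilter_tendsto_integral {X : Type*} [TopologicalSpace X] [T2Space X]
    [NormalSpace X] [MeasurableSpace X] [BorelSpace X] (μ : ℕ → FiniteMeasure X) {K : Set X}
    (hK : IsCompact K) (hμK : ∀ k, μ k Kᶜ = 0) (C : NNReal) (hC : ∀ k, (μ k).mass ≤ C) :
    ∃ (m : FiniteMeasure X) (l : Filter ℕ), l.NeBot ∧ l ≤ atTop ∧
      ∀ f : BoundedContinuousFunction X ℝ,
        Tendsto (fun k => ∫ x, f x ∂(μ k : Measure X)) l (𝓝 (∫ x, f x ∂(m : Measure X))) := by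
  have hcomp := isCompact_setOfPred_finiteMeasure_mass_le_compl_isCompact_le (E := X)
    (u := fun _ => 0) (K := fun _ => K) C tendsto_const_nhds (fun _ => hK) (Or.inl inferInstance)
  obtain ⟨m, -, hm⟩ := hcomp.ultrafilter_le_nhds ((hyperfilter ℕ).map μ) (by
    rw [Ultrafilter.coe_map, le_principal_iff, Filter.mem_map]
    exact Eventually.of_forall fun k => ⟨hC k, fun _ => (hμK k).le⟩)
  refine ⟨m, hyperfilter ℕ, inferInstance, Nat.hyperfilter_le_atTop, ?_⟩
  rwa [← FiniteMeasure.tendsto_iff_forall_integral_tendsto]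

/-- The Gauss–Green formula: the distributional gradient of `1_Ω` is `σ dm` with `m` a finite
measure carried by the boundary. The measure `m` is a weak limit of the strip measures. -/
theorem exists_boundary_measure (hΩ : IsOpen Ω) (hb : Bornology.IsBounded Ω)
    (hfr : volume (frontier Ω) = 0) (h : IsExteriorPotential Ω Γ)
    (hg : ContinuousOn g Ωᶜ) (hgU : ∀ x ∈ (closure Ω)ᶜ, g x = ∇ Γ x) (hg0 : ∀ x ∉ Ω, g x ≠ 0) :
    ∃ (m : Measure (Sp n)) (σ : Sp n → Sp n), IsFiniteMeasure m ∧ m (frontier Ω)ᶜ = 0 ∧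
      Continuous σ ∧ ∀ ψ : Sp n → ℝ, ContDiff ℝ 1 ψ → HasCompactSupport ψ → ∀ v : Sp n,
        ∫ x in Ω, fderiv ℝ ψ x v = -∫ x, ψ x * inner ℝ (σ x) v ∂m := by
  -- a cutoff `η` equal to `1` near `closure Ω`
  obtain ⟨R, hR0, hR⟩ := hb.closure.subset_ball_lt 0 0
  let η : ContDiffBump (0 : Sp n) := ⟨R, R + 1, hR0, by linarith⟩
  have hη1 : ∀ x ∈ closure Ω, η =ᶠ[𝓝 x] 1 := fun x hx => η.eventuallyEq_one_of_mem_ball (hR hx)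
  have hηd : ContDiff ℝ 1 η := η.contDiff
  -- the continuous vector field which extends `∇Γ / |∇Γ|²` from the exterior domain
  obtain ⟨τ, hτ⟩ : ∃ τ : C(Sp n, Sp n), ∀ x ∉ Ω, τ x = (‖g x‖ ^ 2)⁻¹ • g x := by
    have hc : ContinuousOn (fun x => (‖g x‖ ^ 2)⁻¹ • g x) Ωᶜ :=
      ((hg.norm.pow 2).inv₀ fun x hx => by simpa using hg0 x hx).smul hg
    obtain ⟨τ, hτ⟩ := ContinuousMap.exists_restrict_eq hΩ.isClosed_compl ⟨_, hc.domRestrict⟩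
    exact ⟨τ, fun x hx => congrArg (fun f => f ⟨x, hx⟩) hτ⟩
  -- the strip measures and a weak limit of them
  have hρc (k : ℕ) : Continuous (stripDensity Ω Γ η k) :=
    continuous_stripDensity hΩ h η.continuous k
  have hρs (k : ℕ) : HasCompactSupport (stripDensity Ω Γ η k) := η.hasCompactSupport.mul_left
  have hρ0 (k : ℕ) (x : Sp n) : 0 ≤ stripDensity Ω Γ η k x :=
    stripDensity_nonneg hΩ h (fun _ => η.nonneg) k x
  have hρi (k : ℕ) : Integrable (stripDensity Ω Γ η k) :=
    (hρc k).integrable_of_hasCompactSupport (hρs k)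
  have hfin (k : ℕ) := isFiniteMeasure_withDensity_ofReal (hρi k).2
  let μ : ℕ → FiniteMeasure (Sp n) := fun k =>
    ⟨volume.withDensity fun x => ENNReal.ofReal (stripDensity Ω Γ η k x), hfin k⟩
  have hμ (k : ℕ) (f : Sp n → ℝ) :
      ∫ x, f x ∂(μ k : Measure (Sp n)) = ∫ x, stripDensity Ω Γ η k x * f x := by
    change ∫ x, f x ∂(volume.withDensity fun x => ENNReal.ofReal (stripDensity Ω Γ η k x)) = _
    rw [integral_withDensity_eq_integral_toReal_smul (by fun_prop)
      (Eventually.of_forall fun _ => ENNReal.ofReal_lt_top)]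
    simp [ENNReal.toReal_ofReal (hρ0 k _)]
  obtain ⟨C, hC⟩ := exists_integral_stripDensity_le hΩ h hg hgU hηd η.hasCompactSupport
  obtain ⟨m, l, hl, hle, hlim⟩ := exists_ultrafilter_tendsto_integral μ
    (K := tsupport η) η.hasCompactSupport.isCompact (fun k => by
      rw [← ENNReal.coe_inj, FiniteMeasure.ennreal_coeFn_eq_coeFn_toMeasure]
      change (volume.withDensity fun x => ENNReal.ofReal (stripDensity Ω Γ η k x)) _ = 0
      rw [withDensity_apply _ (isClosed_tsupport _).measurableSet.compl]
      refine (setLIntegral_congr_fun (isClosed_tsupport _).measurableSet.compl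
        (g := fun _ => 0) fun x hx => ?_).trans (by simp)
      simp [stripDensity, image_eq_zero_of_notMem_tsupport hx]) C.toNNReal (fun k => by
      rw [← ENNReal.coe_le_coe, FiniteMeasure.ennreal_mass]
      change (volume.withDensity fun x => ENNReal.ofReal (stripDensity Ω Γ η k x)) univ ≤ _
      rw [withDensity_apply _ MeasurableSet.univ, setLIntegral_univ,
        ← ofReal_integral_eq_lintegral_ofReal (hρi k) (Eventually.of_forall (hρ0 k))]
      exact ENNReal.ofReal_le_ofReal (hC k))
  have hlim' {f : Sp n → ℝ} (hf : Continuous f) (hfc : HasCompactSupport f) :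
      Tendsto (fun k => ∫ x, stripDensity Ω Γ η k x * f x) l
        (𝓝 (∫ x, f x ∂(m : Measure (Sp n)))) := by
    obtain ⟨B, hB⟩ := hf.bounded_above_of_compact_support hfc
    have := hlim (BoundedContinuousFunction.ofNormedAddCommGroup f hf B hB)
    simpa [hμ] using this
  refine ⟨m, fun x => -τ x, inferInstance, ?_, τ.continuous.neg, ?_⟩
  · -- away from the boundary the strip densities vanish eventually
    refine measure_null_of_locally_null _ fun x hx => ?_
    obtain ⟨f, hfs, hfc, hfd, hfr', hfx⟩ := exists_contDiff_tsupport_subset (n := 1)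
      (isClosed_frontier.isOpen_compl.mem_nhds hx)
    have hev : ∀ᶠ k in atTop, ∫ x, stripDensity Ω Γ η k x * f x = 0 := by
      have hKU : tsupport f ∩ Ωᶜ ⊆ (closure Ω)ᶜ := fun y hy hyc =>
        hfs hy.1 (by rw [hΩ.frontier_eq]; exact ⟨hyc, hy.2⟩)
      obtain ⟨c, hc0, hc⟩ := (hfc.isCompact.inter_right hΩ.isClosed_compl).exists_forall_le'
        (h.continuousOn.mono inter_subset_right) (a := 0) fun y hy => h.pos y (hKU hy)
      have ht : Tendsto (fun k : ℕ => ((k : ℝ) + 1) * c - 1) atTop atTop :=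
        tendsto_atTop_add_const_right _ _ ((tendsto_atTop_add_const_right _ _
          tendsto_natCast_atTop_atTop).atTop_mul_const hc0)
      filter_upwards [ht.eventually_gt_atTop 1] with k hk
      refine (integral_congr_ae (Eventually.of_forall fun y => ?_)).trans (integral_zero _ _)
      by_cases hy : y ∈ tsupport f
      · rw [stripDensity_eq hΩ h]
        by_cases hyU : y ∈ closure Ω
        · simp [indicator_of_notMem (notMem_compl_iff.2 hyU)]
        · have hcy := hc y ⟨hy, fun hyΩ => hyU (subset_closure hyΩ)⟩
          have h1 : 1 < ((k : ℝ) + 1) * Γ y - 1 := by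
            have : ((k : ℝ) + 1) * c ≤ (k + 1) * Γ y :=
              mul_le_mul_of_nonneg_left hcy (by positivity)
            linarith
          rw [indicator_of_mem (show y ∈ (closure Ω)ᶜ from hyU), deriv_smoothTransition_eq_zero h1]
          simp
      · simp [image_eq_zero_of_notMem_tsupport hy]
    have h0 : ∫ x, f x ∂(m : Measure (Sp n)) = 0 :=
      tendsto_nhds_unique (hlim' hfd.continuous hfc)
        (tendsto_const_nhds.congr' ((hev.filter_mono hle).mono fun k hk => hk.symm))
    have h1 : f =ᵐ[(m : Measure (Sp n))] 0 :=
      (integral_eq_zero_iff_of_nonneg (fun y => (hfr' ⟨y, rfl⟩).1)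
        (hfd.continuous.integrable_of_hasCompactSupport hfc)).1 h0
    refine ⟨{y | f y ≠ 0}, mem_nhdsWithin_of_mem_nhds
      (hfd.continuous.continuousAt.eventually_ne (by simp [hfx])), h1⟩
  · intro ψ hψ hψc v
    -- multiplication by the cutoff `η` changes nothing near `closure Ω`
    set ζ : Sp n → ℝ := fun x => ψ x * η x with hζ
    have hζd : ContDiff ℝ 1 ζ := hψ.mul hηd
    have hζc : HasCompactSupport ζ := hψc.mul_right
    have hdζ : Continuous fun x => fderiv ℝ ζ x v :=
      (hζd.continuous_fderiv (by norm_num)).clm_apply continuous_const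
    have hdζi : Integrable fun x => fderiv ℝ ζ x v :=
      hdζ.integrable_of_hasCompactSupport (hζc.fderiv_apply ℝ v)
    have hA : ∫ x in Ω, fderiv ℝ ψ x v = -∫ x in (closure Ω)ᶜ, fderiv ℝ ζ x v := by
      have h1 : ∫ x in Ω, fderiv ℝ ψ x v = ∫ x in closure Ω, fderiv ℝ ζ x v := by
        have hae : (closure Ω : Set (Sp n)) =ᵐ[volume] Ω := by
          rw [closure_eq_self_union_frontier]
          exact union_ae_eq_left_of_ae_eq_empty (ae_eq_empty.2 hfr)
        rw [setIntegral_congr_set hae]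
        refine setIntegral_congr_fun hΩ.measurableSet fun x hx => ?_
        have : ψ =ᶠ[𝓝 x] ζ := by
          filter_upwards [hη1 x (subset_closure hx)] with y hy
          simp [hζ, hy]
        simp only [this.fderiv_eq]
      have h2 := integral_add_compl (isClosed_closure (s := Ω)).measurableSet hdζi
      rw [integral_fderiv_eq_zero_of_hasCompactSupport (μ := volume) hζd hζc] at h2
      rw [h1]
      linarith
    have hB : Tendsto (fun k => ∫ x, levelCutoff Ω Γ k x * fderiv ℝ ζ x v) atTop
        (𝓝 (∫ x in (closure Ω)ᶜ, fderiv ℝ ζ x v)) := by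
      rw [← integral_indicator (isOpen_compl_closure Ω).measurableSet]
      refine tendsto_integral_of_dominated_convergence (fun x => ‖fderiv ℝ ζ x v‖)
        (fun k => ?_) hdζi.norm (fun k => Eventually.of_forall fun x => ?_)
        (Eventually.of_forall fun x => ?_)
      · exact ((contDiff_levelCutoff hΩ h k).continuous.mul hdζ).aestronglyMeasurable
      · rw [norm_mul]
        exact mul_le_of_le_one_left (norm_nonneg _) (abs_levelCutoff_le_one k x)
      · have := (tendsto_levelCutoff h x).mul_const (fderiv ℝ ζ x v)
        by_cases hx : x ∈ (closure Ω)ᶜ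
        · simpa only [indicator_of_mem hx, one_mul] using this
        · simpa only [indicator_of_notMem hx, zero_mul] using this
    have hD (k : ℕ) : ∫ x, levelCutoff Ω Γ k x * fderiv ℝ ζ x v =
        -∫ x, stripDensity Ω Γ η k x * (ψ x * inner ℝ (τ x) v) := by
      rw [integral_mul_fderiv_eq_neg_of_tsupport_subset isOpen_univ
        (contDiff_levelCutoff hΩ h k).contDiffOn hζd hζc (subset_univ _)]
      congr 2
      ext x
      rw [stripDensity_eq hΩ h, fderiv_levelCutoff hΩ h]
      by_cases hx : x ∈ (closure Ω)ᶜ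
      · have hxΩ : x ∉ Ω := fun hxΩ => hx (subset_closure hxΩ)
        have hne : ‖∇ Γ x‖ ≠ 0 := norm_ne_zero_iff.2 (h.gradient_ne_zero x hx)
        rw [indicator_of_mem hx, hτ x hxΩ, hgU x hx, real_inner_smul_left, inner_gradient_left]
        field_simp
        simp only [hζ]
        ring
      · simp [indicator_of_notMem hx]
    have hE := hlim' (f := fun x => ψ x * inner ℝ (τ x) v)
      (hψ.continuous.mul (τ.continuous.inner continuous_const)) hψc.mul_right
    have := tendsto_nhds_unique (hB.mono_left hle) (hE.neg.congr fun k => (hD k).symm)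
    rw [hA, this]
    simp [integral_neg]

end SurfaceMeasure

/-! ### Blow-ups at a point -/

section BlowUp

open scoped Pointwise

variable {n : ℕ} {Ω : Set (Sp n)}

/-- The rescalings `z ↦ u (x + r z)` converge almost everywhere to `U` as `r` decreases to `0`. -/
def HasBlowUp (u : Sp n → ℝ) (x : Sp n) (U : Sp n → ℝ) : Prop :=
  ∀ᵐ z : Sp n, Tendsto (fun r : ℝ => u (x + r • z)) (𝓝[>] 0) (𝓝 (U z))

/-- The open half of the unit ball on the side of `w`. -/
def halfBall (w : Sp n) : Set (Sp n) :=
  {z | z ∈ Metric.ball 0 1 ∧ 0 < inner ℝ z w}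

lemma isOpen_halfBall (w : Sp n) : IsOpen (halfBall w) :=
  have h : IsOpen {z : Sp n | 0 < inner ℝ z w} := isOpen_lt continuous_const (by fun_prop)
  Metric.isOpen_ball.inter h

lemma halfBall_subset (w : Sp n) : halfBall w ⊆ Metric.ball 0 1 := fun _ hz => hz.1

/-- A vector with positive products with `w`, rescaled, lies in the half ball. -/
lemma exists_smul_mem_halfBall {w z : Sp n} (h : 0 < inner ℝ z w) :
    ∃ c : ℝ, 0 < c ∧ c • z ∈ halfBall w := by
  refine ⟨(1 + ‖z‖)⁻¹, by positivity, ?_, ?_⟩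
  · rw [mem_ball_zero_iff, norm_smul, Real.norm_of_nonneg (by positivity),
      inv_mul_lt_one₀ (by positivity)]
    linarith
  · rw [real_inner_smul_left]
    positivity

lemma setAverage_image_smul_add (f : Sp n → ℝ) (x : Sp n) {r : ℝ} (hr : 0 < r) (S : Set (Sp n)) :
    ⨍ y in (fun z => x + r • z) '' S, f y = ⨍ z in S, f (x + r • z) := by
  have himg : (fun z => x + r • z) '' S = (fun y => x + y) '' (r • S) := by
    rw [← image_smul, image_image]
  have hint : ∫ y in (fun y => x + y) '' (r • S), f y = ∫ y in r • S, f (x + y) :=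
    (measurePreserving_add_left volume x).setIntegral_image_emb
      (measurableEmbedding_addLeft x) f (r • S)
  have hvol : volume.real ((fun y => x + y) '' (r • S)) =
      r ^ Module.finrank ℝ (Sp n) * volume.real S := by
    rw [measureReal_def, image_add_left, measure_preimage_add, Measure.addHaar_smul,
      ENNReal.toReal_mul, abs_of_pos (by positivity), ENNReal.toReal_ofReal (by positivity),
      measureReal_def]
  rw [himg, setAverage_eq, setAverage_eq, hint, hvol,
    Measure.setIntegral_comp_smul_of_pos volume (fun y => f (x + y)) S hr, smul_smul, mul_inv,
    mul_comm]

lemma image_halfBall (x w : Sp n) {r : ℝ} (hr : 0 < r) :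
    (fun z => x + r • z) '' halfBall w =
      {y | y ∈ Metric.ball x r ∧ 0 < inner ℝ (y - x) w} := by
  ext y
  constructor
  · rintro ⟨z, ⟨hz, hzw⟩, rfl⟩
    rw [mem_ball_zero_iff] at hz
    refine ⟨?_, ?_⟩
    · rw [mem_ball_iff_norm, add_sub_cancel_left, norm_smul, Real.norm_of_nonneg hr.le]
      nlinarith
    · simp only [add_sub_cancel_left, real_inner_smul_left]
      positivity
  · rintro ⟨hy, hyw⟩
    rw [mem_ball_iff_norm] at hy
    refine ⟨r⁻¹ • (y - x), ⟨?_, ?_⟩, by simp [smul_smul, hr.ne']⟩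
    · rw [mem_ball_zero_iff, norm_smul, Real.norm_of_nonneg (by positivity),
        inv_mul_lt_one₀ hr]
      exact hy
    · rw [real_inner_smul_left]
      positivity

lemma HasBlowUp.tendsto_setAverage {u U : Sp n → ℝ} {x : Sp n} (h : HasBlowUp u x U)
    (hu : Measurable u) {C : ℝ} (hC : ∀ y, |u y| ≤ C) {S : Set (Sp n)}
    (hS : volume S ≠ ⊤) (c : ℝ) :
    Tendsto (fun r : ℝ => ⨍ y in (fun z => x + r • z) '' S, |u y - c|) (𝓝[>] 0)
      (𝓝 (⨍ z in S, |U z - c|)) := by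
  have h1 : Tendsto (fun r : ℝ => ⨍ z in S, |u (x + r • z) - c|) (𝓝[>] 0)
      (𝓝 (⨍ z in S, |U z - c|)) := by
    simp only [setAverage_eq]
    refine Tendsto.const_smul ?_ _
    have : IsFiniteMeasure (volume.restrict S) := ⟨by simpa using hS.lt_top⟩
    refine tendsto_integral_filter_of_dominated_convergence (fun _ => C + |c|)
      (Eventually.of_forall fun r => ?_) (Eventually.of_forall fun r => Eventually.of_forall
        fun z => ?_) (integrable_const _) ?_
    · have : Measurable fun z => |u (x + r • z) - c| :=
        ((hu.comp (by fun_prop)).sub_const c).abs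
      exact this.aestronglyMeasurable
    · rw [Real.norm_eq_abs, abs_abs]
      exact (abs_sub _ _).trans (add_le_add_left (hC _) _)
    · filter_upwards [ae_restrict_of_ae h] with z hz using (hz.sub_const c).abs
  refine h1.congr' ?_
  filter_upwards [self_mem_nhdsWithin] with r hr
  exact (setAverage_image_smul_add (fun y => |u y - c|) x hr S).symm

lemma volume_halfBall_ne_top (w : Sp n) : volume (halfBall w) ≠ ⊤ :=
  ((measure_mono (halfBall_subset w)).trans_lt measure_ball_lt_top).ne

/-- The average of `|u - c|` over the half balls of `x` shrinking to `x`. -/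
lemma HasBlowUp.tendsto_halfBall {u U : Sp n → ℝ} {x : Sp n} (h : HasBlowUp u x U)
    (hu : Measurable u) {C : ℝ} (hC : ∀ y, |u y| ≤ C) (w : Sp n) (c : ℝ) :
    Tendsto (fun r : ℝ => ⨍ y in {y | y ∈ Metric.ball x r ∧ 0 < inner ℝ (y - x) w}, |u y - c|)
      (𝓝[>] 0) (𝓝 (⨍ z in halfBall w, |U z - c|)) := by
  refine (h.tendsto_setAverage hu hC (volume_halfBall_ne_top w) c).congr' ?_
  filter_upwards [self_mem_nhdsWithin] with r hr
  rw [image_halfBall x w hr]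

lemma inner_neg_iff_inner_neg_right (z w : Sp n) : inner ℝ z w < 0 ↔ 0 < inner ℝ z (-w) := by
  rw [inner_neg_right, neg_pos]

lemma HasBlowUp.isJump {u U : Sp n → ℝ} {x : Sp n} (h : HasBlowUp u x U)
    (hu : Measurable u) {C : ℝ} (hC : ∀ y, |u y| ≤ C) {a b : ℝ} (hab : a < b) {w : Sp n}
    (hw : ‖w‖ = 1) (hb : ∀ z, 0 < inner ℝ z w → U z = b) (ha : ∀ z, inner ℝ z w < 0 → U z = a) :
    IsJump u x a b w := by
  have key (w' : Sp n) (c : ℝ) (hc : ∀ z ∈ halfBall w', U z = c) :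
      ⨍ z in halfBall w', |U z - c| = 0 := by
    rw [setAverage_congr_fun (g := fun _ => 0) (isOpen_halfBall w').measurableSet
      (Eventually.of_forall fun z hz => by simp [hc z hz])]
    simp
  refine ⟨hab, hw, ?_, ?_⟩
  · have := h.tendsto_halfBall hu hC w b
    rwa [key w b fun z hz => hb z hz.2] at this
  · have := h.tendsto_halfBall hu hC (-w) a
    rw [key (-w) a fun z hz => ha z ((inner_neg_iff_inner_neg_right z w).2 hz.2)] at this
    simpa only [inner_neg_iff_inner_neg_right] using this

lemma HasBlowUp.ae_eq_of_isJump {u U : Sp n → ℝ} {x : Sp n} (h : HasBlowUp u x U)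
    (hu : Measurable u) {C : ℝ} (hC : ∀ y, |u y| ≤ C) (hU : Measurable U) (hUC : ∀ y, |U y| ≤ C)
    {a b : ℝ} {w : Sp n} (hj : IsJump u x a b w) :
    (∀ᵐ z : Sp n, z ∈ halfBall w → U z = b) ∧ (∀ᵐ z : Sp n, z ∈ halfBall (-w) → U z = a) := by
  have key (w' : Sp n) (hw' : w' ≠ 0) (c : ℝ) (h0 : ⨍ z in halfBall w', |U z - c| = 0) :
      ∀ᵐ z : Sp n, z ∈ halfBall w' → U z = c := by
    have hne : (halfBall w').Nonempty :=
      let ⟨c, _, hc⟩ := exists_smul_mem_halfBall (real_inner_self_pos.2 hw'); ⟨_, hc⟩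
    have hpos := (isOpen_halfBall w').measure_pos volume hne
    have hvol : volume.real (halfBall w') ≠ 0 :=
      (ENNReal.toReal_pos hpos.ne' (volume_halfBall_ne_top w')).ne'
    rw [setAverage_eq, smul_eq_mul, mul_eq_zero, inv_eq_zero, or_iff_right hvol] at h0
    have : IsFiniteMeasure (volume.restrict (halfBall w')) :=
      ⟨by simpa using (volume_halfBall_ne_top w').lt_top⟩
    have hint : Integrable (fun z => |U z - c|) (volume.restrict (halfBall w')) := by
      refine Integrable.of_bound (C := C + |c|) ((hU.sub_const c).abs).aestronglyMeasurable
        (Eventually.of_forall fun z => ?_)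
      rw [Real.norm_eq_abs, abs_abs]
      exact (abs_sub _ _).trans (add_le_add_left (hUC _) _)
    have h1 := (integral_eq_zero_iff_of_nonneg (fun z => abs_nonneg _) hint).1 h0
    rw [← ae_restrict_iff' (isOpen_halfBall w').measurableSet]
    filter_upwards [h1] with z hz
    simpa [sub_eq_zero] using hz
  have hw : w ≠ 0 := by
    rintro rfl
    simpa using hj.norm_eq_one
  refine ⟨key w hw b ?_, key (-w) (neg_ne_zero.2 hw) a ?_⟩
  · exact tendsto_nhds_unique (h.tendsto_halfBall hu hC w b) hj.tendsto_upper
  · refine tendsto_nhds_unique (h.tendsto_halfBall hu hC (-w) a) ?_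
    simpa only [inner_neg_iff_inner_neg_right] using hj.tendsto_lower

/-- An almost sure property holds somewhere in a nonempty open set. -/
lemma exists_mem_of_ae {S : Set (Sp n)} (hS : IsOpen S) (hne : S.Nonempty) {p : Sp n → Prop}
    (h : ∀ᵐ z : Sp n, p z) : ∃ z ∈ S, p z := by
  by_contra! hcon
  have : volume S = 0 := measure_mono_null (fun z hz => hcon z hz) h
  exact (hS.measure_pos volume hne).ne' this

lemma nonempty_halfBall {w : Sp n} (hw : w ≠ 0) : (halfBall w).Nonempty :=
  let ⟨_, _, hc⟩ := exists_smul_mem_halfBall (real_inner_self_pos.2 hw); ⟨_, hc⟩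

/-! ### Blow-ups of the domain -/

lemma IsDefiningFunctionAt.eq_zero (hΩ : IsOpen Ω) {x : Sp n} (hx : x ∈ frontier Ω)
    {ρ : Sp n → ℝ} (h : IsDefiningFunctionAt Ω x ρ) : ρ x = 0 := by
  rw [hΩ.frontier_eq] at hx
  refine le_antisymm ?_ (not_lt.1 fun hlt => hx.2 (h.eventually_mem_iff.self_of_nhds.2 hlt))
  by_contra! hpos
  obtain ⟨y, hy, h1, h2⟩ := ((mem_closure_iff_frequently.1 hx.1).and_eventually
    (h.eventually_mem_iff.and (h.contDiffAt.continuousAt.eventually (lt_mem_nhds hpos)))).exists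
  exact absurd (h1.1 hy) (not_lt.2 h2.le)

lemma hasDerivAt_comp_ray {ρ : Sp n → ℝ} {x : Sp n} (hρ : DifferentiableAt ℝ ρ x) (z : Sp n) :
    HasDerivAt (fun r : ℝ => ρ (x + r • z)) (inner ℝ (∇ ρ x) z) 0 := by
  have h1 : HasDerivAt (fun r : ℝ => x + r • z) z 0 := by
    simpa using ((hasDerivAt_id (0 : ℝ)).smul_const z).const_add x
  have h2 : HasFDerivAt ρ (fderiv ℝ ρ x) (x + (0 : ℝ) • z) := by simpa using hρ.hasFDerivAt
  rw [inner_gradient_left]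
  exact h2.comp_hasDerivAt 0 h1

lemma tendsto_ray (x z : Sp n) : Tendsto (fun r : ℝ => x + r • z) (𝓝[>] 0) (𝓝 x) := by
  have : Continuous fun r : ℝ => x + r • z := by fun_prop
  simpa using (this.tendsto 0).mono_left nhdsWithin_le_nhds

lemma IsDefiningFunctionAt.eventually_ray_mem (hΩ : IsOpen Ω) {x : Sp n} (hx : x ∈ frontier Ω)
    {ρ : Sp n → ℝ} (h : IsDefiningFunctionAt Ω x ρ) {z : Sp n} (hz : inner ℝ (∇ ρ x) z < 0) :
    ∀ᶠ r : ℝ in 𝓝[>] 0, x + r • z ∈ Ω := by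
  have hd := hasDerivAt_comp_ray (h.contDiffAt.differentiableAt (by norm_num)) z
  have hs := eventually_nhdsWithin_sign_eq_of_deriv_neg (f := fun r : ℝ => ρ (x + r • z))
    (x₀ := 0) (by rwa [hd.deriv]) (by simpa using h.eq_zero hΩ hx)
  filter_upwards [hs.filter_mono nhdsWithin_le_nhds, self_mem_nhdsWithin,
    (tendsto_ray x z).eventually h.eventually_mem_iff] with r h1 h2 h3
  rw [zero_sub, sign_neg (neg_neg_iff_pos.2 h2), sign_eq_neg_one_iff] at h1
  exact h3.2 h1

lemma IsDefiningFunctionAt.eventually_ray_notMem (hΩ : IsOpen Ω) {x : Sp n}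
    (hx : x ∈ frontier Ω) {ρ : Sp n → ℝ} (h : IsDefiningFunctionAt Ω x ρ) {z : Sp n}
    (hz : 0 < inner ℝ (∇ ρ x) z) : ∀ᶠ r : ℝ in 𝓝[>] 0, x + r • z ∉ closure Ω := by
  have hd := hasDerivAt_comp_ray (h.contDiffAt.differentiableAt (by norm_num)) z
  have hs := eventually_nhdsWithin_sign_eq_of_deriv_pos (f := fun r : ℝ => ρ (x + r • z))
    (x₀ := 0) (by rwa [hd.deriv]) (by simpa using h.eq_zero hΩ hx)
  have hev := (h.contDiffAt.eventually (by simp)).and h.eventually_mem_iff.eventually_nhds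
  filter_upwards [hs.filter_mono nhdsWithin_le_nhds, self_mem_nhdsWithin,
    (tendsto_ray x z).eventually hev] with r h1 h2 hev' hcl
  rw [sub_zero, sign_pos (show (0 : ℝ) < r from h2), sign_eq_one_iff] at h1
  have h3 : ∀ᶠ y in 𝓝 (x + r • z), 0 < ρ y :=
    hev'.1.continuousAt.eventually (lt_mem_nhds h1)
  obtain ⟨y, hy, h5, h6⟩ := ((mem_closure_iff_frequently.1 hcl).and_eventually
    (hev'.2.and h3)).exists
  exact absurd (h5.1 hy) (not_lt.2 h6.le)

lemma ae_inner_ne_zero {w : Sp n} (hw : w ≠ 0) : ∀ᵐ z : Sp n, inner ℝ w z ≠ 0 := by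
  have := Measure.addHaar_submodule (volume : Measure (Sp n)) (Submodule.span ℝ {w})ᗮ
    (fun htop => by
      have hmem : w ∈ (Submodule.span ℝ {w})ᗮ := by rw [htop]; exact Submodule.mem_top
      rw [Submodule.mem_orthogonal_singleton_iff_inner_right, inner_self_eq_zero] at hmem
      exact hw hmem)
  rw [ae_iff]
  refine measure_mono_null (fun z hz => ?_) this
  exact Submodule.mem_orthogonal_singleton_iff_inner_right.2 (not_not.1 hz)

/-- The blow-up of a domain at a boundary point is a half space. -/
lemma IsDefiningFunctionAt.hasBlowUp (hΩ : IsOpen Ω) {x : Sp n} (hx : x ∈ frontier Ω)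
    {ρ : Sp n → ℝ} (h : IsDefiningFunctionAt Ω x ρ) :
    HasBlowUp (Ω.indicator fun _ => (1 : ℝ)) x
      fun z => if inner ℝ (∇ ρ x) z < 0 then 1 else 0 := by
  filter_upwards [ae_inner_ne_zero h.gradient_ne_zero] with z hz
  refine tendsto_const_nhds.congr' ?_
  rcases lt_or_gt_of_ne hz with hz | hz
  · filter_upwards [h.eventually_ray_mem hΩ hx hz] with r hr
    rw [indicator_of_mem hr, if_pos hz]
  · filter_upwards [h.eventually_ray_notMem hΩ hx hz] with r hr
    rw [indicator_of_notMem fun h' => hr (subset_closure h'), if_neg hz.not_gt]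

lemma IsDefiningFunctionAt.hasBlowUp_frontier (hΩ : IsOpen Ω) {x : Sp n} (hx : x ∈ frontier Ω)
    {ρ : Sp n → ℝ} (h : IsDefiningFunctionAt Ω x ρ) :
    HasBlowUp ((frontier Ω).indicator fun _ => (1 : ℝ)) x fun _ => 0 := by
  filter_upwards [ae_inner_ne_zero h.gradient_ne_zero] with z hz
  refine tendsto_const_nhds.congr' ?_
  rcases lt_or_gt_of_ne hz with hz | hz
  · filter_upwards [h.eventually_ray_mem hΩ hx hz] with r hr
    rw [indicator_of_notMem]
    rw [hΩ.frontier_eq]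
    exact fun h' => h'.2 hr
  · filter_upwards [h.eventually_ray_notMem hΩ hx hz] with r hr
    rw [indicator_of_notMem fun h' => hr (frontier_subset_closure h')]

/-- The boundary has density `0` at each of its points, so that it is a null set. -/
lemma IsC2Domain.volume_frontier (hΩ : IsC2Domain Ω) : volume (frontier Ω) = 0 := by
  have hm : MeasurableSet (frontier Ω) := isClosed_frontier.measurableSet
  have hfalse : ∀ᵐ x ∂(volume.restrict (frontier Ω)), False := by
    filter_upwards [Besicovitch.ae_tendsto_measure_inter_div volume (frontier Ω),
      ae_restrict_mem hm] with x hx hxf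
    obtain ⟨ρ, hρ⟩ := hΩ.2 x hxf
    have h1 := (hρ.hasBlowUp_frontier hΩ.1 hxf).tendsto_setAverage
      (measurable_const.indicator hm) (C := 1) (fun y => by
        unfold indicator; split_ifs <;> simp) (S := Metric.closedBall 0 1)
      measure_closedBall_lt_top.ne 0
    have h2 := (ENNReal.tendsto_toReal ENNReal.one_ne_top).comp hx
    have h3 : (1 : ENNReal).toReal = ⨍ z in Metric.closedBall (0 : Sp n) 1, |(0 : ℝ) - 0| := by
      refine tendsto_nhds_unique h2 (h1.congr' ?_)
      filter_upwards [self_mem_nhdsWithin] with r hr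
      have himg : (fun z => x + r • z) '' Metric.closedBall (0 : Sp n) 1 =
          Metric.closedBall x r := by
        rw [← affinity_unitClosedBall (le_of_lt hr) x, ← image_smul, ← image_vadd, image_image]
        rfl
      have hind (y : Sp n) : |(frontier Ω).indicator (fun _ => (1 : ℝ)) y - 0| =
          (frontier Ω).indicator 1 y := by
        unfold indicator; split_ifs <;> simp
      simp only [himg, setAverage_eq, hind]
      rw [integral_indicator_one hm, measureReal_restrict_apply hm]
      simp [measureReal_def, ENNReal.toReal_div, div_eq_inv_mul]
    simp at h3
  simpa using hfalse

lemma IsC2Domain.hausdorffMeasure_frontier (hΩ : IsC2Domain Ω) :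
    Measure.hausdorffMeasure (n : ℝ) (frontier Ω) = 0 := by
  have h1 : (Measure.hausdorffMeasure (Module.finrank ℝ (Sp n) : ℝ) : Measure (Sp n)) ≪ volume :=
    Measure.absolutelyContinuous_isAddHaarMeasure _ _
  have h2 := h1 hΩ.volume_frontier
  rwa [finrank_euclideanSpace_fin] at h2

/-! ### The jump set of the characteristic function -/

lemma measurable_indicator_one (hΩ : IsOpen Ω) : Measurable (Ω.indicator fun _ => (1 : ℝ)) :=
  measurable_const.indicator hΩ.measurableSet

lemma abs_indicator_one_le (S : Set (Sp n)) (y : Sp n) :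
    |S.indicator (fun _ => (1 : ℝ)) y| ≤ 1 := by
  unfold indicator; split_ifs <;> simp

lemma IsDefiningFunctionAt.isJump (hΩ : IsOpen Ω) {x : Sp n} (hx : x ∈ frontier Ω)
    {ρ : Sp n → ℝ} (h : IsDefiningFunctionAt Ω x ρ) :
    IsJump (Ω.indicator fun _ => (1 : ℝ)) x 0 1 (-(‖∇ ρ x‖⁻¹ • ∇ ρ x)) := by
  have hne := norm_pos_iff.2 h.gradient_ne_zero
  have hi (z : Sp n) : inner ℝ z (-(‖∇ ρ x‖⁻¹ • ∇ ρ x)) = -(‖∇ ρ x‖⁻¹ * inner ℝ (∇ ρ x) z) := by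
    rw [inner_neg_right, real_inner_smul_right, real_inner_comm]
  refine (h.hasBlowUp hΩ hx).isJump (measurable_indicator_one hΩ) (abs_indicator_one_le Ω)
    zero_lt_one ?_ (fun z hz => ?_) (fun z hz => ?_)
  · rw [norm_neg, norm_smul, norm_inv, norm_norm, inv_mul_cancel₀ hne.ne']
  · rw [hi, ← mul_neg, mul_pos_iff_of_pos_left (by positivity), neg_pos] at hz
    exact if_pos hz
  · rw [hi, neg_lt_zero, mul_pos_iff_of_pos_left (by positivity)] at hz
    exact if_neg hz.not_gt

/-- At a boundary point the jump is unique: from `0` to `1` across the inward normal. -/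
lemma IsDefiningFunctionAt.eq_of_isJump (hΩ : IsOpen Ω) {x : Sp n} (hx : x ∈ frontier Ω)
    {ρ : Sp n → ℝ} (h : IsDefiningFunctionAt Ω x ρ) {a b : ℝ} {w : Sp n}
    (hj : IsJump (Ω.indicator fun _ => (1 : ℝ)) x a b w) :
    a = 0 ∧ b = 1 ∧ w = -(‖∇ ρ x‖⁻¹ • ∇ ρ x) := by
  set N := ‖∇ ρ x‖⁻¹ • ∇ ρ x with hN
  have hne := norm_pos_iff.2 h.gradient_ne_zero
  have hmU : Measurable fun z : Sp n => if inner ℝ (∇ ρ x) z < 0 then (1 : ℝ) else 0 :=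
    Measurable.ite (isOpen_lt (by fun_prop) continuous_const).measurableSet measurable_const
      measurable_const
  obtain ⟨h1, h2⟩ := (h.hasBlowUp hΩ hx).ae_eq_of_isJump (measurable_indicator_one hΩ)
    (abs_indicator_one_le Ω) hmU (fun z => by split_ifs <;> simp) hj
  have hw : w ≠ 0 := by
    rintro rfl
    simpa using hj.norm_eq_one
  obtain ⟨z, hz, hzb⟩ := exists_mem_of_ae (isOpen_halfBall w) (nonempty_halfBall hw) h1
  obtain ⟨y, hy, hya⟩ := exists_mem_of_ae (isOpen_halfBall (-w))
    (nonempty_halfBall (neg_ne_zero.2 hw)) h2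
  have hb := hzb hz
  have ha := hya hy
  have hlt := hj.lt
  have hab : a = 0 ∧ b = 1 := by
    split_ifs at ha hb <;> constructor <;> linarith
  refine ⟨hab.1, hab.2, ?_⟩
  by_contra hcon
  have hN1 : ‖N‖ = 1 := by rw [hN, norm_smul, norm_inv, norm_norm, inv_mul_cancel₀ hne.ne']
  -- otherwise `w + N` points to both open half spaces
  have hpos : 0 < 1 + inner ℝ w N := by
    have h3 : 0 < ‖w + N‖ ^ 2 := by
      have : w + N ≠ 0 := fun h0 => hcon (eq_neg_of_add_eq_zero_left h0)
      positivity
    rw [norm_add_sq_real, hj.norm_eq_one, hN1] at h3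
    linarith
  have h4 : 0 < inner ℝ (w + N) w := by
    rw [inner_add_left, real_inner_self_eq_norm_sq, hj.norm_eq_one, real_inner_comm]
    linarith
  have h5 : 0 < inner ℝ (∇ ρ x) (w + N) := by
    have : 0 < inner ℝ N (w + N) := by
      rw [inner_add_right, real_inner_self_eq_norm_sq, hN1, real_inner_comm]
      linarith
    rw [hN, real_inner_smul_left] at this
    exact (mul_pos_iff_of_pos_left (by positivity)).1 this
  obtain ⟨c, hc, hmem⟩ := exists_smul_mem_halfBall h4
  obtain ⟨z', ⟨hz', hz''⟩, hzb'⟩ := exists_mem_of_ae (S := halfBall w ∩ {z | 0 < inner ℝ (∇ ρ x) z})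
    ((isOpen_halfBall w).inter (isOpen_lt continuous_const (by fun_prop)))
    ⟨c • (w + N), hmem, by
      change 0 < inner ℝ (∇ ρ x) (c • (w + N))
      rw [real_inner_smul_right]; positivity⟩ h1
  have := hzb' hz'
  rw [hab.2, if_neg (not_lt.2 (le_of_lt hz''))] at this
  exact zero_ne_one this

/-- A characteristic function has no jump off the boundary. -/
lemma mem_frontier_of_isJump (hΩ : IsOpen Ω) {x : Sp n} {a b : ℝ} {w : Sp n}
    (hj : IsJump (Ω.indicator fun _ => (1 : ℝ)) x a b w) : x ∈ frontier Ω := by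
  by_contra hx
  have hev : ∃ c : ℝ, |c| ≤ 1 ∧ ∀ᶠ y in 𝓝 x, Ω.indicator (fun _ => (1 : ℝ)) y = c := by
    by_cases hxΩ : x ∈ Ω
    · refine ⟨1, by simp, ?_⟩
      filter_upwards [hΩ.mem_nhds hxΩ] with y hy using indicator_of_mem hy _
    · refine ⟨0, by simp, ?_⟩
      have : x ∈ (closure Ω)ᶜ := fun hcl => hx (by rw [hΩ.frontier_eq]; exact ⟨hcl, hxΩ⟩)
      filter_upwards [(isOpen_compl_closure Ω).mem_nhds this] with y hy
      exact indicator_of_notMem (fun h' => hy (subset_closure h')) _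
  obtain ⟨c, hc, hev⟩ := hev
  have hbl : HasBlowUp (Ω.indicator fun _ => (1 : ℝ)) x fun _ => c :=
    Eventually.of_forall fun z => tendsto_const_nhds.congr'
      (((tendsto_ray x z).eventually hev).mono fun r hr => hr.symm)
  obtain ⟨h1, h2⟩ := hbl.ae_eq_of_isJump (measurable_indicator_one hΩ)
    (abs_indicator_one_le Ω) measurable_const (fun _ => hc) hj
  have hw : w ≠ 0 := by
    rintro rfl
    simpa using hj.norm_eq_one
  obtain ⟨z, hz, hzb⟩ := exists_mem_of_ae (isOpen_halfBall w) (nonempty_halfBall hw) h1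
  obtain ⟨y, hy, hya⟩ := exists_mem_of_ae (isOpen_halfBall (-w))
    (nonempty_halfBall (neg_ne_zero.2 hw)) h2
  exact hj.lt.ne ((hya hy).symm.trans (hzb hz))

end BlowUp

/-! ### The one-dimensional profile of the calibration -/

section Profile

/-- The amount `((β + q) t - q)⁺` by which `β t` exceeds `(1 - t) q`. -/
def excess (β q t : ℝ) : ℝ := max 0 ((β + q) * t - q)

/-- The primitive `∫₀ᵗ 2 min (β s, (1 - s) q) ds`, for `t` in `[0, 1]`, in closed form. -/
def profile (β q t : ℝ) : ℝ := β * t ^ 2 - excess β q t ^ 2 / (β + q)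

/-- The derivative of the profile with respect to `q`. -/
def profileDeriv (β q t : ℝ) : ℝ :=
  2 * excess β q t * (1 - t) / (β + q) + excess β q t ^ 2 / (β + q) ^ 2

lemma hasDerivAt_max_zero_sq (s : ℝ) :
    HasDerivAt (fun s : ℝ => max 0 s ^ 2) (2 * max 0 s) s := by
  rcases lt_trichotomy s 0 with hs | rfl | hs
  · rw [max_eq_left hs.le, mul_zero]
    refine (hasDerivAt_const s (0 : ℝ)).congr_of_eventuallyEq ?_
    filter_upwards [gt_mem_nhds hs] with y hy
    rw [max_eq_left (le_of_lt hy)]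
    norm_num
  · rw [max_self, mul_zero, hasDerivAt_iff_isLittleO_nhds_zero]
    have h1 : (fun h : ℝ => h ^ 2) =o[𝓝 0] fun h => h := by
      simpa using Asymptotics.isLittleO_pow_pow (𝕜 := ℝ) (m := 1) (n := 2) (by norm_num)
    refine Asymptotics.IsBigO.trans_isLittleO ?_ h1
    refine Asymptotics.IsBigO.of_norm_le fun h => ?_
    simp only [zero_add, max_self, smul_zero, sub_zero, norm_pow, Real.norm_eq_abs, ne_eq,
      OfNat.ofNat_ne_zero, not_false_eq_true, zero_pow]
    rw [← sq_abs h]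
    refine pow_le_pow_left₀ (abs_nonneg _) ?_ 2
    rw [abs_of_nonneg (le_max_left 0 h)]
    exact max_le (abs_nonneg h) (le_abs_self h)
  · rw [max_eq_right hs.le]
    have h1 : HasDerivAt (fun s : ℝ => s ^ 2) (2 * s) s := by simpa using hasDerivAt_pow 2 s
    refine h1.congr_of_eventuallyEq ?_
    filter_upwards [lt_mem_nhds hs] with y hy
    rw [max_eq_right (le_of_lt hy)]

lemma contDiff_max_zero_sq : ContDiff ℝ 1 fun s : ℝ => max 0 s ^ 2 := by
  rw [contDiff_one_iff_deriv]
  refine ⟨fun s => (hasDerivAt_max_zero_sq s).differentiableAt, ?_⟩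
  rw [show deriv (fun s : ℝ => max 0 s ^ 2) = fun s => 2 * max 0 s from
    funext fun s => (hasDerivAt_max_zero_sq s).deriv]
  fun_prop

variable {β D q t : ℝ}

lemma hasDerivAt_profile_right (h : β + q ≠ 0) :
    HasDerivAt (fun t => profile β q t) (2 * β * t - 2 * excess β q t) t := by
  have h1 : HasDerivAt (fun t : ℝ => (β + q) * t - q) (β + q) t := by
    simpa using ((hasDerivAt_id t).const_mul (β + q)).sub_const q
  have h2 := (hasDerivAt_max_zero_sq _).comp t h1
  have h3 := ((hasDerivAt_pow 2 t).const_mul β).sub (h2.div_const (β + q))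
  refine h3.congr_deriv ?_
  simp only [excess]
  field_simp
  ring

lemma hasDerivAt_profile_left (h : β + q ≠ 0) :
    HasDerivAt (fun q => profile β q t) (profileDeriv β q t) q := by
  have h1 : HasDerivAt (fun q : ℝ => (β + q) * t - q) (1 * t - 1) q :=
    (((hasDerivAt_id' q).const_add β).mul_const t).sub (hasDerivAt_id' q)
  have h2 := (hasDerivAt_max_zero_sq _).comp q h1
  have h3 := (h2.div ((hasDerivAt_id q).const_add β) h).const_sub (β * t ^ 2)
  refine h3.congr_deriv ?_
  simp only [profileDeriv, excess, Function.comp_apply, id]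
  field_simp
  ring

lemma excess_of_le (h : (β + q) * t ≤ q) : excess β q t = 0 := max_eq_left (by linarith)

lemma excess_of_ge (h : q ≤ (β + q) * t) : excess β q t = (β + q) * t - q :=
  max_eq_right (by linarith)

lemma excess_nonneg : 0 ≤ excess β q t := le_max_left _ _

/-- For `t` in `[0, 1]` the horizontal speed `2 (β t - excess)` lies between `0` and `2 β t`. -/
lemma excess_le (hβ : 0 ≤ β) (hq : 0 ≤ q) (ht : t ∈ Icc (0 : ℝ) 1) : excess β q t ≤ β * t :=
  max_le (mul_nonneg hβ ht.1) (by nlinarith [ht.2])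

/-- The vertical component of the calibration at a point with divergence `D` of the normal field. -/
def verticalSpeed (β D q t : ℝ) : ℝ :=
  profile β q t * D - (q * D + q ^ 2) * profileDeriv β q t

lemma verticalSpeed_of_le (h : (β + q) * t ≤ q) : verticalSpeed β D q t = β * D * t ^ 2 := by
  simp only [verticalSpeed, profile, profileDeriv, excess_of_le h]
  ring

lemma verticalSpeed_of_ge (hβq : β + q ≠ 0) (h : q ≤ (β + q) * t) :
    verticalSpeed β D q t = ((1 - t) * q) ^ 2 - (β ^ 2 - β * D) * (q / (β + q)) ^ 2 := by
  simp only [verticalSpeed, profile, profileDeriv, excess_of_ge h]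
  field_simp
  ring

end Profile

/-! ### The calibrating field and its divergence -/

section Field

variable {n : ℕ} {Ω : Set (Sp n)} {Γ : Sp n → ℝ} {g : Sp n → Sp n} {β γ : ℝ}

/-- The logarithmic slope `|∇Γ| / Γ` of the potential. -/
def slope (Γ : Sp n → ℝ) (x : Sp n) : ℝ := ‖∇ Γ x‖ / Γ x

lemma sum_apply_single {F : Type*} [AddCommGroup F] [Module ℝ F] [TopologicalSpace F]
    (L : Sp n →L[ℝ] F) (v : Sp n) :
    ∑ i : Fin n, v i • L (EuclideanSpace.single i 1) = L v := by
  conv_rhs => rw [← (EuclideanSpace.basisFun (Fin n) ℝ).sum_repr v]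
  simp

namespace IsExteriorPotential

variable {x : Sp n}

lemma slope_pos (h : IsExteriorPotential Ω Γ) (hx : x ∈ (closure Ω)ᶜ) : 0 < slope Γ x :=
  div_pos (norm_pos_iff.2 (h.gradient_ne_zero x hx)) (h.pos x hx)

lemma contDiffOn_norm_gradient (h : IsExteriorPotential Ω Γ) :
    ContDiffOn ℝ 1 (fun x => ‖∇ Γ x‖) (closure Ω)ᶜ :=
  h.contDiffOn_gradient.norm ℝ h.gradient_ne_zero

lemma contDiffOn_nuField (h : IsExteriorPotential Ω Γ) : ContDiffOn ℝ 1 (nuField Γ) (closure Ω)ᶜ :=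
  (h.contDiffOn_norm_gradient.inv fun x hx =>
    norm_ne_zero_iff.2 (h.gradient_ne_zero x hx)).smul h.contDiffOn_gradient

lemma contDiffOn_slope (h : IsExteriorPotential Ω Γ) : ContDiffOn ℝ 1 (slope Γ) (closure Ω)ᶜ :=
  h.contDiffOn_norm_gradient.div (h.contDiffOn.of_le (by norm_num)) fun x hx => (h.pos x hx).ne'

lemma norm_nuField (h : IsExteriorPotential Ω Γ) (hx : x ∈ (closure Ω)ᶜ) : ‖nuField Γ x‖ = 1 := by
  rw [nuField, norm_smul, norm_inv, norm_norm,
    inv_mul_cancel₀ (norm_ne_zero_iff.2 (h.gradient_ne_zero x hx))]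

/-- The derivative of `|∇Γ|` along the flow lines, read off from
`0 = div ∇Γ = div (|∇Γ| ν)`. -/
lemma fderiv_norm_gradient_nuField (h : IsExteriorPotential Ω Γ)
    (hx : x ∈ (closure Ω)ᶜ) :
    fderiv ℝ (fun x => ‖∇ Γ x‖) x (nuField Γ x) = -(‖∇ Γ x‖ * divergence (nuField Γ) x) := by
  have hU := (isOpen_compl_closure Ω).mem_nhds hx
  have hs0 : ‖∇ Γ x‖ ≠ 0 := norm_ne_zero_iff.2 (h.gradient_ne_zero x hx)
  have hs := (h.contDiffOn_norm_gradient.contDiffAt hU).differentiableAt (by norm_num)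
  have hν := (h.contDiffOn_nuField.contDiffAt hU).differentiableAt (by norm_num)
  have hG : ∇ Γ =ᶠ[𝓝 x] fun y => ‖∇ Γ y‖ • nuField Γ y := by
    filter_upwards [hU] with y hy
    rw [nuField, smul_smul, mul_inv_cancel₀ (norm_ne_zero_iff.2 (h.gradient_ne_zero y hy)),
      one_smul]
  have h0 := h.divergence_gradient hx
  simp only [divergence, hG.fderiv_eq, fderiv_fun_smul hs hν, add_apply,
    FunLike.coe_smul, Pi.smul_apply, ContinuousLinearMap.smulRight_apply, PiLp.add_apply,
    PiLp.smul_apply, smul_eq_mul, Finset.sum_add_distrib, ← Finset.mul_sum] at h0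
  rw [← sum_apply_single (fderiv ℝ (fun x => ‖∇ Γ x‖) x) (nuField Γ x)]
  simp only [smul_eq_mul, divergence]
  simp only [mul_comm] at h0 ⊢
  linarith

lemma fderiv_slope_nuField (h : IsExteriorPotential Ω Γ) (hx : x ∈ (closure Ω)ᶜ) :
    fderiv ℝ (slope Γ) x (nuField Γ x) =
      -(slope Γ x * divergence (nuField Γ) x + slope Γ x ^ 2) := by
  have hU := (isOpen_compl_closure Ω).mem_nhds hx
  have hs0 : ‖∇ Γ x‖ ≠ 0 := norm_ne_zero_iff.2 (h.gradient_ne_zero x hx)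
  have hΓ0 := (h.pos x hx).ne'
  have hΓ := (h.contDiffOn.contDiffAt hU).differentiableAt (by norm_num)
  have hq := (h.contDiffOn_slope.contDiffAt hU).differentiableAt (by norm_num)
  have h1 : (fun y => ‖∇ Γ y‖) =ᶠ[𝓝 x] fun y => slope Γ y * Γ y := by
    filter_upwards [hU] with y hy
    rw [slope, div_mul_cancel₀ _ (h.pos y hy).ne']
  have h2 : fderiv ℝ Γ x (nuField Γ x) = ‖∇ Γ x‖ := by
    rw [← inner_gradient_left, nuField, real_inner_smul_right, real_inner_self_eq_norm_sq]
    field_simp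
  have h3 := h.fderiv_norm_gradient_nuField hx
  rw [h1.fderiv_eq, fderiv_fun_mul hq hΓ] at h3
  simp only [add_apply, FunLike.coe_smul, Pi.smul_apply, smul_eq_mul, h2,
    show ‖∇ Γ x‖ = slope Γ x * Γ x from h1.self_of_nhds] at h3
  refine mul_left_cancel₀ hΓ0 ?_
  linarith

end IsExteriorPotential

/-- The calibrating field. Between the levels `0` and `1` it equals
`(-2 min (β t, (1 - t) |∇Γ| / Γ) ν, φᵗ)` outside `closure Ω`, and on the boundary it equals
`(-2 β t ν, 0)`, where `ν` is the direction of the extension `g` of `∇Γ`. -/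
def calibration (β : ℝ) (Ω : Set (Sp n)) (Γ : Sp n → ℝ) (g : Sp n → Sp n) (p : SpT n) : SpT n :=
  open scoped Classical in
  if p.snd ∈ Icc (0 : ℝ) 1 then
    if p.fst ∈ closure Ω then pt (-(2 * β * p.snd) • ‖g p.fst‖⁻¹ • g p.fst) 0
    else pt (-(2 * β * p.snd - 2 * excess β (slope Γ p.fst) p.snd) • nuField Γ p.fst)
      (verticalSpeed β (divergence (nuField Γ) p.fst) (slope Γ p.fst) p.snd)
  else 0

/-- A component of the vector potential `W = w ν`, with `w` the profile: off the boundary and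
between the levels the calibrating field is `(-∂ₜ W, div W)`. -/
def vectorPotential (β : ℝ) (Γ : Sp n → ℝ) (i : Fin n) (p : SpT n) : ℝ :=
  nuField Γ p.fst i * profile β (slope Γ p.fst) p.snd

lemma contDiff_fst : ContDiff ℝ 1 fun p : SpT n => p.fst := (WithLp.fstL 2 ℝ (Sp n) ℝ).contDiff

lemma contDiff_snd : ContDiff ℝ 1 fun p : SpT n => p.snd := (WithLp.sndL 2 ℝ (Sp n) ℝ).contDiff

lemma continuous_fst_SpT : Continuous fun p : SpT n => p.fst := contDiff_fst.continuous

lemma continuous_snd_SpT : Continuous fun p : SpT n => p.snd := contDiff_snd.continuous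

lemma contDiffOn_vectorPotential (hβ : 0 < β) (h : IsExteriorPotential Ω Γ) (i : Fin n) :
    ContDiffOn ℝ 1 (vectorPotential β Γ i) {p : SpT n | p.fst ∉ closure Ω} := by
  have hmaps : MapsTo (fun p : SpT n => p.fst) {p : SpT n | p.fst ∉ closure Ω} (closure Ω)ᶜ :=
    fun p hp => hp
  have hν : ContDiffOn ℝ 1 (fun p : SpT n => nuField Γ p.fst i) {p : SpT n | p.fst ∉ closure Ω} :=
    ((EuclideanSpace.proj (𝕜 := ℝ) i).contDiff.comp_contDiffOn h.contDiffOn_nuField).comp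
      contDiff_fst.contDiffOn hmaps
  have hq : ContDiffOn ℝ 1 (fun p : SpT n => slope Γ p.fst) {p : SpT n | p.fst ∉ closure Ω} :=
    h.contDiffOn_slope.comp contDiff_fst.contDiffOn hmaps
  have ht := contDiff_snd.contDiffOn (s := {p : SpT n | p.fst ∉ closure Ω})
  have hβq := (contDiffOn_const (c := β)).add hq
  refine hν.mul (((contDiffOn_const (c := β)).mul (ht.pow 2)).sub (ContDiffOn.div ?_ hβq
    fun p hp => (add_pos hβ (h.slope_pos hp)).ne'))
  exact contDiff_max_zero_sq.comp_contDiffOn ((hβq.mul ht).sub hq)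

lemma fderiv_vectorPotential_vertical (hβ : 0 < β) (h : IsExteriorPotential Ω Γ) (i : Fin n)
    {p : SpT n} (hp : p.fst ∉ closure Ω) :
    fderiv ℝ (vectorPotential β Γ i) p (pt 0 1) =
      nuField Γ p.fst i * (2 * β * p.snd - 2 * excess β (slope Γ p.fst) p.snd) := by
  have hV : IsOpen {p : SpT n | p.fst ∉ closure Ω} :=
    (isOpen_compl_closure Ω).preimage continuous_fst_SpT
  have hd := (((contDiffOn_vectorPotential hβ h i).contDiffAt (hV.mem_nhds hp)).differentiableAt
    (by norm_num)).hasFDerivAt.hasLineDerivAt (pt 0 1)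
  have hβq : β + slope Γ p.fst ≠ 0 := (add_pos hβ (h.slope_pos hp)).ne'
  have h0 : p.snd + (0 : ℝ) = p.snd := add_zero _
  have h1 : HasDerivAt (fun s : ℝ => profile β (slope Γ p.fst) (p.snd + s)) _ 0 :=
    HasDerivAt.comp_const_add p.snd 0 (hasDerivAt_profile_right hβq)
  have h2 := h1.const_mul (nuField Γ p.fst i)
  rw [h0] at h2
  refine HasDerivAt.unique hd (h2.congr_of_eventuallyEq (Eventually.of_forall fun s => ?_))
  simp [vectorPotential, pt]

lemma fderiv_vectorPotential_horizontal (hβ : 0 < β) (h : IsExteriorPotential Ω Γ) (i : Fin n)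
    {p : SpT n} (hp : p.fst ∉ closure Ω) (v : Sp n) :
    fderiv ℝ (vectorPotential β Γ i) p (pt v 0) =
      fderiv ℝ (nuField Γ) p.fst v i * profile β (slope Γ p.fst) p.snd +
      nuField Γ p.fst i * (profileDeriv β (slope Γ p.fst) p.snd * fderiv ℝ (slope Γ) p.fst v) := by
  have hV : IsOpen {p : SpT n | p.fst ∉ closure Ω} :=
    (isOpen_compl_closure Ω).preimage continuous_fst_SpT
  have hU := (isOpen_compl_closure Ω).mem_nhds (show p.fst ∈ (closure Ω)ᶜ from hp)
  have hd := (((contDiffOn_vectorPotential hβ h i).contDiffAt (hV.mem_nhds hp)).differentiableAt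
    (by norm_num)).hasFDerivAt.hasLineDerivAt (pt v 0)
  have hβq : β + slope Γ p.fst ≠ 0 := (add_pos hβ (h.slope_pos hp)).ne'
  have hν : HasFDerivAt (fun y => nuField Γ y i) _ p.fst :=
    (EuclideanSpace.proj (𝕜 := ℝ) i).hasFDerivAt.comp p.fst
      ((h.contDiffOn_nuField.contDiffAt hU).differentiableAt (by norm_num)).hasFDerivAt
  have hq := ((h.contDiffOn_slope.contDiffAt hU).differentiableAt (by norm_num)).hasFDerivAt
  have h1 : HasFDerivAt (fun y => profile β (slope Γ y) p.snd) _ p.fst :=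
    (hasDerivAt_profile_left hβq).comp_hasFDerivAt p.fst hq
  have h2 := (hν.mul h1).hasLineDerivAt v
  refine (HasDerivAt.unique hd (HasDerivAt.congr_of_eventuallyEq h2
    (Eventually.of_forall fun s => ?_))).trans ?_
  · simp [vectorPotential, pt]
  · simp
    ring

lemma calibration_eq_of_mem (h : IsExteriorPotential Ω Γ) (hβ : 0 < β) {p : SpT n}
    (hp : p.fst ∉ closure Ω) (ht : p.snd ∈ Icc (0 : ℝ) 1) :
    calibration β Ω Γ g p =
      ∑ i : Fin n, (-fderiv ℝ (vectorPotential β Γ i) p (pt 0 1) •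
          pt (EuclideanSpace.single i 1) 0 +
        fderiv ℝ (vectorPotential β Γ i) p (pt (EuclideanSpace.single i 1) 0) • pt 0 1) := by
  have hq := h.fderiv_slope_nuField (show p.fst ∈ (closure Ω)ᶜ from hp)
  rw [calibration, if_pos ht, if_neg hp, Finset.sum_add_distrib, ← Finset.sum_smul]
  have h1 : ∑ i : Fin n, -fderiv ℝ (vectorPotential β Γ i) p (pt 0 1) •
      pt (EuclideanSpace.single i 1) 0 =
      pt (-(2 * β * p.snd - 2 * excess β (slope Γ p.fst) p.snd) • nuField Γ p.fst) 0 := by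
    let L : Sp n →L[ℝ] SpT n :=
      (WithLp.prodContinuousLinearEquiv 2 ℝ (Sp n) ℝ).symm.toContinuousLinearMap.comp
        (ContinuousLinearMap.inl ℝ (Sp n) ℝ)
    have hL (v : Sp n) : pt v 0 = L v := rfl
    rw [hL, ← sum_apply_single L]
    refine Finset.sum_congr rfl fun i _ => ?_
    rw [fderiv_vectorPotential_vertical hβ h i hp, hL]
    congr 1
    simp only [PiLp.smul_apply, smul_eq_mul]
    ring
  have h2 : ∑ i : Fin n,
      fderiv ℝ (vectorPotential β Γ i) p (pt (EuclideanSpace.single i 1) 0) =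
      verticalSpeed β (divergence (nuField Γ) p.fst) (slope Γ p.fst) p.snd := by
    simp only [fderiv_vectorPotential_horizontal hβ h _ hp, Finset.sum_add_distrib,
      ← Finset.sum_mul]
    have h3 : ∑ i : Fin n, nuField Γ p.fst i * (profileDeriv β (slope Γ p.fst) p.snd *
        fderiv ℝ (slope Γ) p.fst (EuclideanSpace.single i 1)) =
        profileDeriv β (slope Γ p.fst) p.snd * fderiv ℝ (slope Γ) p.fst (nuField Γ p.fst) := by
      rw [← sum_apply_single (fderiv ℝ (slope Γ) p.fst) (nuField Γ p.fst), Finset.mul_sum]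
      exact Finset.sum_congr rfl fun i _ => by rw [smul_eq_mul]; ring
    rw [h3, hq, verticalSpeed, divergence]
    ring
  rw [h1, h2]
  simp [pt, ← WithLp.toLp_smul, ← WithLp.toLp_add]

lemma isDivergenceFreeOn_calibration (hβ : 0 < β) (h : IsExteriorPotential Ω Γ) :
    IsDivergenceFreeOn (calibration β Ω Γ g)
      {p | p.fst ∉ closure Ω ∧ p.snd ∈ Ioo (0 : ℝ) 1} := by
  intro ψ hψ hψc hsupp
  have hV : IsOpen {p : SpT n | p.fst ∉ closure Ω} :=
    (isOpen_compl_closure Ω).preimage continuous_fst_SpT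
  have hsupp' : tsupport ψ ⊆ {p : SpT n | p.fst ∉ closure Ω} := fun p hp => (hsupp hp).1
  have hint (i : Fin n) := integral_fderiv_mul_fderiv_sub_eq_zero (μ := volume) hV
    (contDiffOn_vectorPotential hβ h i) (hψ.of_le (WithTop.coe_le_coe.2 le_top)) hψc hsupp'
  rw [setIntegral_eq_integral_of_forall_compl_eq_zero]
  · have heq : ∀ p : SpT n, inner ℝ (calibration β Ω Γ g p) (∇ ψ p) = ∑ i : Fin n,
        (fderiv ℝ (vectorPotential β Γ i) p (pt (EuclideanSpace.single i 1) 0) *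
            fderiv ℝ ψ p (pt 0 1) -
          fderiv ℝ (vectorPotential β Γ i) p (pt 0 1) *
            fderiv ℝ ψ p (pt (EuclideanSpace.single i 1) 0)) := by
      intro p
      rw [real_inner_comm, inner_gradient_left]
      by_cases hp : p ∈ tsupport ψ
      · rw [calibration_eq_of_mem h hβ (hsupp hp).1 (Ioo_subset_Icc_self (hsupp hp).2)]
        simp only [map_sum, map_add, map_smul, smul_eq_mul]
        exact Finset.sum_congr rfl fun i _ => by ring
      · have : fderiv ℝ ψ p = 0 :=
          image_eq_zero_of_notMem_tsupport fun h' => hp (tsupport_fderiv_subset ℝ h')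
        simp [this]
    simp only [heq]
    rw [integral_finsetSum]
    · exact Finset.sum_eq_zero fun i _ => (hint i _ _).2
    · exact fun i _ => (hint i _ _).1.sub (hint i _ _).1
  · intro p hp
    have : fderiv ℝ ψ p = 0 :=
      image_eq_zero_of_notMem_tsupport fun h' => hp (hsupp (tsupport_fderiv_subset ℝ h'))
    rw [real_inner_comm, inner_gradient_left, this]
    rfl

end Field

/-! ### Approximate regularity -/

section ApproxRegularity

variable {n : ℕ}

lemma approxTendsto_of_continuousWithinAt {F : Type*} [NormedAddCommGroup F]
    [InnerProductSpace ℝ F] [FiniteDimensional ℝ F] [MeasurableSpace F] [BorelSpace F]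
    {A : Set F} {h : F → ℝ} {p : F} (hc : ContinuousWithinAt h A p) :
    ApproxTendsto A h p (h p) := by
  intro ε hε
  obtain ⟨δ, hδ, hclose⟩ := Metric.continuousWithinAt_iff.1 hc ε hε
  refine tendsto_const_nhds.congr' ?_
  filter_upwards [Ioo_mem_nhdsGT hδ] with r hr
  have : {q | q ∈ A ∩ Metric.ball p r ∧ ε < |h q - h p|} = ∅ := by
    refine eq_empty_of_forall_notMem fun q ⟨⟨hqA, hq⟩, hlt⟩ => ?_
    have := hclose hqA ((Metric.mem_ball.1 hq).trans hr.2)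
    rw [Real.dist_eq] at this
    linarith
  rw [this, measure_empty, ENNReal.zero_div]

lemma inner_SpT (p q : SpT n) : inner ℝ p q = inner ℝ p.fst q.fst + p.snd * q.snd := by
  rw [WithLp.prod_inner_apply]
  simp [mul_comm]

lemma norm_le_fst_add_snd (p : SpT n) : ‖p‖ ≤ ‖p.fst‖ + |p.snd| := by
  have h := WithLp.prod_norm_sq_eq_of_L2 p
  rw [Real.norm_eq_abs] at h
  refine abs_le_of_sq_le_sq' ?_ (by positivity) |>.2
  nlinarith [norm_nonneg p.fst, abs_nonneg p.snd]

lemma norm_fst_le (p : SpT n) : ‖p.fst‖ ≤ ‖p‖ := by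
  have h := WithLp.prod_norm_sq_eq_of_L2 p
  refine abs_le_of_sq_le_sq' ?_ (by positivity) |>.2
  nlinarith [sq_nonneg ‖p.snd‖]

/-- Where `M` has a normal vector that is not horizontal, nearby points of `M` satisfy a Lipschitz
estimate of the height in terms of the base point. -/
lemma IsUnitNormal.exists_lipschitz_bound {M : Set (SpT n)} {p ν : SpT n}
    (h : IsUnitNormal M p ν) (hν : ν.snd ≠ 0) :
    ∃ k : ℕ, ∀ y ∈ M, dist y p < 1 / (k + 1) → |y.snd - p.snd| ≤ k * ‖y.fst - p.fst‖ := by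
  have hb : 0 < |ν.snd| := abs_pos.2 hν
  set c := |ν.snd| / 2 with hc
  have hc0 : 0 < c := by positivity
  obtain ⟨δ, hδ, hclose⟩ := Metric.mem_nhdsWithin_iff.1 (h.2.bound hc0)
  obtain ⟨k₁, hk₁⟩ := exists_nat_one_div_lt hδ
  obtain ⟨k₂, hk₂⟩ := exists_nat_ge ((c + 1) / c)
  refine ⟨max k₁ k₂, fun y hy hdist => ?_⟩
  have hyδ : y ∈ Metric.ball p δ := by
    refine hdist.trans (lt_of_le_of_lt ?_ hk₁)
    gcongr
    exact le_max_left _ _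
  have h1 : ‖inner ℝ (y - p) ν‖ ≤ c * ‖y - p‖ := hclose ⟨hyδ, hy⟩
  have hfst : (y - p).fst = y.fst - p.fst := rfl
  have hsnd : (y - p).snd = y.snd - p.snd := rfl
  have h2 : |(y.snd - p.snd) * ν.snd| ≤
      ‖inner ℝ (y - p) ν‖ + |inner ℝ (y.fst - p.fst) ν.fst| := by
    rw [inner_SpT, hfst, hsnd, Real.norm_eq_abs]
    calc |(y.snd - p.snd) * ν.snd| = |(inner ℝ (y.fst - p.fst) ν.fst + (y.snd - p.snd) * ν.snd) -
          inner ℝ (y.fst - p.fst) ν.fst| := by congr 1; ring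
      _ ≤ _ := abs_sub _ _
  have h3 : |inner ℝ (y.fst - p.fst) ν.fst| ≤ ‖y.fst - p.fst‖ := by
    refine (abs_real_inner_le_norm _ _).trans (mul_le_of_le_one_right (norm_nonneg _) ?_)
    exact (norm_fst_le ν).trans h.1.le
  have h4 := norm_le_fst_add_snd (y - p)
  rw [hfst, hsnd] at h4
  rw [abs_mul] at h2
  have h5 : |y.snd - p.snd| * c ≤ (c + 1) * ‖y.fst - p.fst‖ := by
    have : |ν.snd| = 2 * c := by rw [hc]; ring
    rw [this] at h2
    nlinarith
  calc |y.snd - p.snd| ≤ (c + 1) / c * ‖y.fst - p.fst‖ := by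
        rw [div_mul_eq_mul_div, le_div_iff₀ hc0]
        exact h5
    _ ≤ (max k₁ k₂ : ℕ) * ‖y.fst - p.fst‖ := by
        gcongr
        exact hk₂.trans (by exact_mod_cast le_max_right _ _)

/-- A set on which the height is a Lipschitz function of the base point is null if its projection
is. -/
lemma hausdorffMeasure_eq_zero_of_lipschitz {S : Set (SpT n)} {C : Set (Sp n)} {d : ℝ}
    (hd : 0 ≤ d) (hC : Measure.hausdorffMeasure d C = 0) (hSC : ∀ p ∈ S, p.fst ∈ C) (k : ℕ)
    (hS : ∀ p ∈ S, ∀ y ∈ S, |y.snd - p.snd| ≤ k * ‖y.fst - p.fst‖) :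
    Measure.hausdorffMeasure d S = 0 := by
  rcases S.eq_empty_or_nonempty with rfl | ⟨p₀, hp₀⟩
  · simp
  have hne : Nonempty (SpT n) := ⟨p₀⟩
  set fst : SpT n → Sp n := fun p => p.fst with hfst
  set inv := Function.invFunOn fst S with hinv
  have hmem : ∀ x ∈ fst '' S, inv x ∈ S ∧ (inv x).fst = x := fun x hx =>
    ⟨Function.invFunOn_mem hx, Function.invFunOn_eq hx⟩
  have hdist : ∀ p ∈ S, ∀ y ∈ S, dist y p ≤ (k + 1) * dist y.fst p.fst := by
    intro p hp y hy
    rw [dist_eq_norm, dist_eq_norm]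
    have h1 := norm_le_fst_add_snd (y - p)
    have h2 := hS p hp y hy
    change ‖y - p‖ ≤ ‖y.fst - p.fst‖ + |y.snd - p.snd| at h1
    linarith
  have hlip : LipschitzOnWith (k + 1) inv (fst '' S) := by
    refine LipschitzOnWith.of_dist_le_mul fun x hx y hy => ?_
    have := hdist _ (hmem y hy).1 _ (hmem x hx).1
    rw [(hmem x hx).2, (hmem y hy).2] at this
    simpa using this
  have hsub : S ⊆ inv '' (fst '' S) := by
    intro p hp
    refine ⟨p.fst, ⟨p, hp, rfl⟩, ?_⟩
    have h1 := hmem p.fst ⟨p, hp, rfl⟩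
    have h2 := hdist p hp _ h1.1
    rw [h1.2, dist_self, mul_zero] at h2
    exact dist_le_zero.1 h2
  have h0 : Measure.hausdorffMeasure d (fst '' S) = 0 :=
    measure_mono_null (by rintro _ ⟨p, hp, rfl⟩; exact hSC p hp) hC
  refine measure_mono_null hsub (le_antisymm ((hlip.hausdorffMeasure_image_le hd).trans ?_) zero_le)
  rw [h0, mul_zero]

/-- Over a null set of base points, a set has almost nowhere a normal vector that is not
horizontal. -/
lemma hausdorffMeasure_nonhorizontal_eq_zero (M : Set (SpT n)) {C : Set (Sp n)} {d : ℝ}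
    (hd : 0 ≤ d) (hC : Measure.hausdorffMeasure d C = 0) :
    Measure.hausdorffMeasure d
      {p | p ∈ M ∧ p.fst ∈ C ∧ ∃ ν, IsUnitNormal M p ν ∧ ν.snd ≠ 0} = 0 := by
  let S : ℕ → ℕ → Set (SpT n) := fun k j => {p | p ∈ M ∧ p.fst ∈ C ∧
    (∀ y ∈ M, dist y p < 1 / (k + 1) → |y.snd - p.snd| ≤ k * ‖y.fst - p.fst‖) ∧
    dist p (TopologicalSpace.denseSeq (SpT n) j) < 1 / (k + 1) / 2}
  have hsub : {p | p ∈ M ∧ p.fst ∈ C ∧ ∃ ν, IsUnitNormal M p ν ∧ ν.snd ≠ 0} ⊆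
      ⋃ k, ⋃ j, S k j := by
    rintro p ⟨hpM, hpC, ν, hν, hν0⟩
    obtain ⟨k, hk⟩ := hν.exists_lipschitz_bound hν0
    obtain ⟨_, hj, ⟨j, rfl⟩⟩ := Metric.dense_iff.1 (TopologicalSpace.denseRange_denseSeq (SpT n)) p
      (1 / ((k : ℝ) + 1) / 2) (by positivity)
    exact mem_iUnion₂.2 ⟨k, j, hpM, hpC, hk, by rw [dist_comm]; exact hj⟩
  refine measure_mono_null hsub (measure_iUnion_null fun k => measure_iUnion_null fun j => ?_)
  refine hausdorffMeasure_eq_zero_of_lipschitz hd hC (fun p hp => hp.2.1) k fun p hp y hy => ?_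
  refine hp.2.2.1 y hy.1 ?_
  calc dist y p ≤ _ := dist_triangle_right _ _ (TopologicalSpace.denseSeq (SpT n) j)
    _ < 1 / (k + 1) / 2 + 1 / (k + 1) / 2 := add_lt_add hy.2.2.2 hp.2.2.2
    _ = 1 / (k + 1) := by ring

end ApproxRegularity

/-! ### Measurability of the calibrating field -/

section FieldProperties

variable {n : ℕ} {Ω : Set (Sp n)} {Γ : Sp n → ℝ} {g : Sp n → Sp n} {β γ : ℝ}

lemma continuousOn_divergence_nuField (h : IsExteriorPotential Ω Γ) :
    ContinuousOn (divergence (nuField Γ)) (closure Ω)ᶜ := by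
  refine continuousOn_finsetSum _ fun i _ => ?_
  exact (EuclideanSpace.proj (𝕜 := ℝ) i).continuous.comp_continuousOn
    ((h.contDiffOn_nuField.continuousOn_fderiv_of_isOpen (isOpen_compl_closure Ω) le_rfl).clm_apply
      continuousOn_const)

lemma continuousOn_exterior_field (h : IsExteriorPotential Ω Γ) (hβ : 0 < β) :
    ContinuousOn (fun p : SpT n =>
      pt (-(2 * β * p.snd - 2 * excess β (slope Γ p.fst) p.snd) • nuField Γ p.fst)
        (verticalSpeed β (divergence (nuField Γ) p.fst) (slope Γ p.fst) p.snd))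
      {p | p.fst ∉ closure Ω} := by
  have hmaps : MapsTo (fun p : SpT n => p.fst) {p : SpT n | p.fst ∉ closure Ω} (closure Ω)ᶜ :=
    fun p hp => hp
  have hf := continuous_fst_SpT (n := n).continuousOn (s := {p | p.fst ∉ closure Ω})
  have ht := continuous_snd_SpT (n := n).continuousOn (s := {p | p.fst ∉ closure Ω})
  have hν := h.contDiffOn_nuField.continuousOn.comp hf hmaps
  have hq := h.contDiffOn_slope.continuousOn.comp hf hmaps
  have hD := (continuousOn_divergence_nuField h).comp hf hmaps
  have hβq := (continuousOn_const (c := β)).add hq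
  have hne : ∀ p ∈ {p : SpT n | p.fst ∉ closure Ω}, β + slope Γ p.fst ≠ 0 := fun p hp =>
    (add_pos hβ (h.slope_pos hp)).ne'
  have he : ContinuousOn (fun p : SpT n => excess β (slope Γ p.fst) p.snd)
      {p | p.fst ∉ closure Ω} := ContinuousOn.sup continuousOn_const ((hβq.mul ht).sub hq)
  have hw : ContinuousOn (fun p : SpT n => profile β (slope Γ p.fst) p.snd)
      {p | p.fst ∉ closure Ω} :=
    (continuousOn_const.mul (ht.pow 2)).sub ((he.pow 2).div hβq hne)
  have hw' : ContinuousOn (fun p : SpT n => profileDeriv β (slope Γ p.fst) p.snd)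
      {p | p.fst ∉ closure Ω} :=
    (((continuousOn_const.mul he).mul (continuousOn_const.sub ht)).div hβq hne).add
      ((he.pow 2).div (hβq.pow 2) fun p hp => pow_ne_zero 2 (hne p hp))
  have h1 := (((continuousOn_const (c := 2 * β)).mul ht).sub
    ((continuousOn_const (c := (2 : ℝ))).mul he)).neg.smul hν
  have h2 := (hw.mul hD).sub (((hq.mul hD).add (hq.pow 2)).mul hw')
  exact (WithLp.prod_continuous_toLp 2 (Sp n) ℝ).comp_continuousOn (h1.prodMk h2)

lemma measurable_calibration (h : IsExteriorPotential Ω Γ) (hβ : 0 < β)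
    (hg : ContinuousOn g Ωᶜ) (hg0 : ∀ x ∉ Ω, g x ≠ 0) :
    Measurable fun p : {p : SpT n // p.fst ∉ Ω} => calibration β Ω Γ g p := by
  classical
  have hf : Continuous fun p : {p : SpT n // p.fst ∉ Ω} => p.1.fst :=
    continuous_fst_SpT.comp continuous_subtype_val
  have ht : Continuous fun p : {p : SpT n // p.fst ∉ Ω} => p.1.snd :=
    continuous_snd_SpT.comp continuous_subtype_val
  have hgc : Continuous fun p : {p : SpT n // p.fst ∉ Ω} => g p.1.fst :=
    hg.comp_continuous hf fun p => p.2
  have hA : Continuous fun p : {p : SpT n // p.fst ∉ Ω} =>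
      pt (-(2 * β * p.1.snd) • ‖g p.1.fst‖⁻¹ • g p.1.fst) 0 :=
    (WithLp.prod_continuous_toLp 2 (Sp n) ℝ).comp
      (((continuous_const.mul ht).neg.smul ((hgc.norm.inv₀ fun p =>
        norm_ne_zero_iff.2 (hg0 _ p.2)).smul hgc)).prodMk continuous_const)
  have hB := (continuousOn_exterior_field h hβ).comp
    (continuous_subtype_val (p := fun p : SpT n => p.fst ∉ Ω)).continuousOn
    (s := {p : {p : SpT n // p.fst ∉ Ω} | p.1.fst ∈ closure Ω}ᶜ) (fun p hp => hp)
  have hS : MeasurableSet {p : {p : SpT n // p.fst ∉ Ω} | p.1.fst ∈ closure Ω} :=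
    (isClosed_closure.preimage hf).measurableSet
  have hpw := hA.continuousOn.measurable_piecewise hB hS
  have hS1 : MeasurableSet {p : {p : SpT n // p.fst ∉ Ω} | p.1.snd ∈ Icc (0 : ℝ) 1} :=
    (isClosed_Icc.preimage ht).measurableSet
  convert Measurable.ite hS1 hpw (measurable_const (a := (0 : SpT n))) using 2 with p
  · simp only [calibration, piecewise, mem_ofPred_eq, Function.comp_apply]
  · infer_instance

lemma calibration_pt_of_notMem (x : Sp n) {t : ℝ} (ht : t ∉ Icc (0 : ℝ) 1) :
    calibration β Ω Γ g (pt x t) = 0 := if_neg ht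

lemma calibration_pt_of_mem_closure {x : Sp n} {t : ℝ} (ht : t ∈ Icc (0 : ℝ) 1)
    (hx : x ∈ closure Ω) :
    calibration β Ω Γ g (pt x t) = pt (-(2 * β * t) • ‖g x‖⁻¹ • g x) 0 :=
  (if_pos ht).trans (if_pos hx)

lemma calibration_pt_of_notMem_closure {x : Sp n} {t : ℝ} (ht : t ∈ Icc (0 : ℝ) 1)
    (hx : x ∉ closure Ω) :
    calibration β Ω Γ g (pt x t) =
      pt (-(2 * β * t - 2 * excess β (slope Γ x) t) • nuField Γ x)
        (verticalSpeed β (divergence (nuField Γ) x) (slope Γ x) t) :=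
  (if_pos ht).trans (if_neg hx)

end FieldProperties

/-! ### Flux, bounds and regularity of the calibrating field -/

section FieldBounds

variable {n : ℕ} {Ω : Set (Sp n)} {Γ : Sp n → ℝ} {g : Sp n → Sp n} {β γ : ℝ}

/-- The horizontal component is `-c ν`, with a continuous speed `0 ≤ c ≤ 2 β t`, between the
levels `0` and `1`, and vanishes elsewhere. -/
lemma exists_calibration_fst_eq (h : IsExteriorPotential Ω Γ) (hβ : 0 < β)
    (hgU : ∀ x ∈ (closure Ω)ᶜ, g x = ∇ Γ x) (x : Sp n) :
    ∃ c : ℝ → ℝ, Continuous c ∧ (∀ t ∈ Icc (0 : ℝ) 1, 0 ≤ c t ∧ c t ≤ 2 * β * t) ∧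
      ∀ t, (calibration β Ω Γ g (pt x t)).fst =
        (Icc (0 : ℝ) 1).indicator (fun t => -c t) t • ‖g x‖⁻¹ • g x := by
  by_cases hx : x ∈ closure Ω
  · refine ⟨fun t => 2 * β * t, by fun_prop, fun t ht => ⟨?_, le_rfl⟩, fun t => ?_⟩
    · have := ht.1
      positivity
    · by_cases ht : t ∈ Icc (0 : ℝ) 1
      · rw [calibration_pt_of_mem_closure ht hx, indicator_of_mem ht]
        rfl
      · rw [calibration_pt_of_notMem x ht, indicator_of_notMem ht, zero_smul]
        rfl
  · refine ⟨fun t => 2 * β * t - 2 * excess β (slope Γ x) t, by unfold excess; fun_prop,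
      fun t ht => ⟨?_, ?_⟩, fun t => ?_⟩
    · have := excess_le hβ.le (h.slope_pos hx).le ht
      linarith
    · have := excess_nonneg (β := β) (q := slope Γ x) (t := t)
      linarith
    · by_cases ht : t ∈ Icc (0 : ℝ) 1
      · rw [calibration_pt_of_notMem_closure ht hx, indicator_of_mem ht, hgU x hx]
        rfl
      · rw [calibration_pt_of_notMem x ht, indicator_of_notMem ht, zero_smul]
        rfl

lemma norm_calibration_fst_le (h : IsExteriorPotential Ω Γ) (hβ : 0 < β)
    (hgU : ∀ x ∈ (closure Ω)ᶜ, g x = ∇ Γ x) (x : Sp n) (t : ℝ) :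
    ‖(calibration β Ω Γ g (pt x t)).fst‖ ≤ (Icc (0 : ℝ) 1).indicator (fun t => 2 * β * t) t := by
  obtain ⟨c, -, hc, heq⟩ := exists_calibration_fst_eq h hβ hgU x
  have hN : ‖‖g x‖⁻¹ • g x‖ ≤ 1 := by
    rw [norm_smul, norm_inv, norm_norm]
    exact inv_mul_le_one
  rw [heq, norm_smul]
  refine (mul_le_of_le_one_right (norm_nonneg _) hN).trans ?_
  by_cases ht : t ∈ Icc (0 : ℝ) 1
  · rw [indicator_of_mem ht, indicator_of_mem ht, norm_neg, Real.norm_of_nonneg (hc t ht).1]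
    exact (hc t ht).2
  · simp [indicator_of_notMem ht]

lemma calibration_flux_bound (h : IsExteriorPotential Ω Γ) (hβ : 0 < β)
    (hgU : ∀ x ∈ (closure Ω)ᶜ, g x = ∇ Γ x) (x : Sp n) {r s : ℝ} (hrs : r < s) :
    IntervalIntegrable (fun t => (calibration β Ω Γ g (pt x t)).fst) volume r s ∧
      ‖∫ t in r..s, (calibration β Ω Γ g (pt x t)).fst‖ ≤ β * (r ^ 2 + s ^ 2) := by
  constructor
  · obtain ⟨c, hcc, -, heq⟩ := exists_calibration_fst_eq h hβ hgU x
    simp only [heq]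
    have h1 : Integrable ((Icc (0 : ℝ) 1).indicator fun t => -c t) :=
      (integrable_indicator_iff measurableSet_Icc).2
        (hcc.neg.continuousOn.integrableOn_compact isCompact_Icc)
    exact (h1.smul_const _).intervalIntegrable
  · -- the flux is at most `∫ 2 β t⁺`
    have hint : IntervalIntegrable (fun t : ℝ => β * (2 * max 0 t)) volume r s :=
      Continuous.intervalIntegrable (by fun_prop) r s
    have h1 := intervalIntegral.norm_integral_le_of_norm_le hrs.le
      (f := fun t => (calibration β Ω Γ g (pt x t)).fst) (Eventually.of_forall fun t _ => ?_) hint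
    · refine h1.trans ?_
      have h2 := intervalIntegral.integral_eq_sub_of_hasDerivAt
        (fun t _ => (hasDerivAt_max_zero_sq t).const_mul β) hint
      rw [h2]
      have h3 : max 0 s ^ 2 ≤ s ^ 2 := by
        rcases le_total 0 s with hs | hs
        · rw [max_eq_right hs]
        · rw [max_eq_left hs]
          simpa using sq_nonneg s
      nlinarith [sq_nonneg r, sq_nonneg (max 0 r)]
    · refine (norm_calibration_fst_le h hβ hgU x t).trans ?_
      by_cases ht : t ∈ Icc (0 : ℝ) 1
      · rw [indicator_of_mem ht, max_eq_right ht.1]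
        linarith
      · rw [indicator_of_notMem ht]
        exact mul_nonneg hβ.le (mul_nonneg zero_le_two (le_max_left 0 t))

/-- The total flux between the levels `0` and `1` at a boundary point. -/
lemma integral_calibration_fst_of_mem_closure {x : Sp n} (hx : x ∈ closure Ω) :
    ∫ t in (0 : ℝ)..1, (calibration β Ω Γ g (pt x t)).fst = -β • ‖g x‖⁻¹ • g x := by
  have h1 : ∫ t in (0 : ℝ)..1, (calibration β Ω Γ g (pt x t)).fst =
      ∫ t in (0 : ℝ)..1, (-(2 * β * t)) • ‖g x‖⁻¹ • g x := by
    refine intervalIntegral.integral_congr fun t ht => ?_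
    rw [uIcc_of_le zero_le_one] at ht
    simp only [calibration_pt_of_mem_closure ht hx]
    rfl
  rw [h1, intervalIntegral.integral_smul_const]
  congr 1
  rw [intervalIntegral.integral_neg, intervalIntegral.integral_const_mul, integral_id]
  ring

lemma deltaFun_eq (h : IsExteriorPotential Ω Γ) (hβ : 0 < β) {x : Sp n}
    (hx : x ∈ (closure Ω)ᶜ) : deltaFun β Γ x = slope Γ x / (β + slope Γ x) := by
  have h1 := norm_pos_iff.2 (h.gradient_ne_zero x hx)
  have h2 := h.pos x hx
  rw [deltaFun, slope]
  have h3 : ‖∇ Γ x‖ + β * Γ x ≠ 0 := by positivity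
  have h4 : β * Γ x + ‖∇ Γ x‖ ≠ 0 := by positivity
  field_simp
  ring

/-- The pointwise inequality for the vertical component. Below the level `δ` it follows from the
hypothesis because `t ≤ δ`; above, it is the hypothesis itself. -/
lemma sq_speed_le_verticalSpeed {D q t : ℝ} (hβ : 0 < β) (hq : 0 < q) (ht : t ∈ Icc (0 : ℝ) 1)
    (hcond : (β ^ 2 - β * D) * (q / (β + q)) ^ 2 ≤ γ ^ 2) :
    (β * t - excess β q t) ^ 2 - volumeTerm γ t ≤ verticalSpeed β D q t := by
  have hβq : 0 < β + q := by positivity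
  rcases le_total ((β + q) * t) q with hle | hle
  · rw [verticalSpeed_of_le hle, excess_of_le hle]
    rcases ht.1.eq_or_lt with rfl | h0
    · simp [volumeTerm]
    · rw [volumeTerm, indicator_of_mem (show t ∈ Ioc (0 : ℝ) 1 from ⟨h0, ht.2⟩)]
      have htδ : t ≤ q / (β + q) := by
        rw [le_div_iff₀ hβq]
        linarith
      have hsq : t ^ 2 ≤ (q / (β + q)) ^ 2 := pow_le_pow_left₀ ht.1 htδ 2
      rcases le_total (β ^ 2 - β * D) 0 with hneg | hpos
      · nlinarith [sq_nonneg t, sq_nonneg γ]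
      · nlinarith [mul_le_mul_of_nonneg_left hsq hpos]
  · rw [verticalSpeed_of_ge hβq.ne' hle, excess_of_ge hle]
    have h0 : 0 < t := by
      by_contra! hcon
      nlinarith
    rw [volumeTerm, indicator_of_mem (show t ∈ Ioc (0 : ℝ) 1 from ⟨h0, ht.2⟩)]
    nlinarith

lemma abs_verticalSpeed_le {C D q t : ℝ} (hβ : 0 < β) (hq : 0 < q) (ht : t ∈ Icc (0 : ℝ) 1)
    (hD : |D| ≤ C) : |verticalSpeed β D q t| ≤ 2 * β ^ 2 + β * C := by
  have hβq : 0 < β + q := by positivity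
  have hC : 0 ≤ C := (abs_nonneg D).trans hD
  have hβD : |β * D| ≤ β * C := by
    rw [abs_mul, abs_of_pos hβ]
    exact mul_le_mul_of_nonneg_left hD hβ.le
  rcases le_total ((β + q) * t) q with hle | hle
  · rw [verticalSpeed_of_le hle, abs_mul, abs_of_nonneg (sq_nonneg t)]
    have : |β * D| * t ^ 2 ≤ |β * D| := mul_le_of_le_one_right (abs_nonneg _)
      (pow_le_one₀ ht.1 ht.2)
    nlinarith [sq_nonneg β]
  · rw [verticalSpeed_of_ge hβq.ne' hle]
    have h1 : ((1 - t) * q) ^ 2 ≤ β ^ 2 := by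
      refine pow_le_pow_left₀ (mul_nonneg (by linarith [ht.2]) hq.le) ?_ 2
      nlinarith [ht.2]
    have h2 : (q / (β + q)) ^ 2 ≤ 1 :=
      pow_le_one₀ (by positivity) ((div_le_one hβq).2 (by linarith))
    have h3 : |(β ^ 2 - β * D) * (q / (β + q)) ^ 2| ≤ β ^ 2 + β * C := by
      rw [abs_mul, abs_of_nonneg (sq_nonneg (q / (β + q)))]
      refine (mul_le_of_le_one_right (abs_nonneg _) h2).trans ((abs_sub _ _).trans ?_)
      rw [abs_of_nonneg (sq_nonneg β)]
      linarith
    refine (abs_sub _ _).trans ?_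
    rw [abs_of_nonneg (sq_nonneg _)]
    linarith

lemma calibration_bounded (h : IsExteriorPotential Ω Γ) (hβ : 0 < β)
    (hgU : ∀ x ∈ (closure Ω)ᶜ, g x = ∇ Γ x) {C : ℝ} (hC0 : 0 ≤ C)
    (hC : ∀ x ∈ (closure Ω)ᶜ, |divergence (nuField Γ) x| ≤ C) (x : Sp n) {t : ℝ}
    (ht : t ∈ Icc (0 : ℝ) 1) :
    ‖calibration β Ω Γ g (pt x t)‖ ≤ 2 * β + (2 * β ^ 2 + β * C) := by
  refine (norm_le_fst_add_snd _).trans (add_le_add ?_ ?_)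
  · refine (norm_calibration_fst_le h hβ hgU x t).trans ?_
    rw [indicator_of_mem ht]
    exact mul_le_of_le_one_right (by positivity) ht.2
  · by_cases hx : x ∈ closure Ω
    · rw [calibration_pt_of_mem_closure ht hx]
      change |(0 : ℝ)| ≤ _
      rw [abs_zero]
      positivity
    · rw [calibration_pt_of_notMem_closure ht hx]
      exact abs_verticalSpeed_le hβ (h.slope_pos hx) ht (hC x hx)

lemma calibration_lower_bound (h : IsExteriorPotential Ω Γ) (hβ : 0 < β)
    (hcond : ∀ x ∈ (closure Ω)ᶜ,
      (β ^ 2 - β * divergence (nuField Γ) x) * deltaFun β Γ x ^ 2 ≤ γ ^ 2)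
    {x : Sp n} (hx : x ∉ closure Ω) {t : ℝ} (ht : t ∈ Icc (0 : ℝ) 1) :
    1 / 4 * ‖(calibration β Ω Γ g (pt x t)).fst‖ ^ 2 - volumeTerm γ t ≤
      (calibration β Ω Γ g (pt x t)).snd := by
  have hc := hcond x hx
  rw [deltaFun_eq h hβ hx] at hc
  have h1 := sq_speed_le_verticalSpeed hβ (h.slope_pos hx) ht hc
  rw [calibration_pt_of_notMem_closure ht hx]
  change 1 / 4 * ‖-(2 * β * t - 2 * excess β (slope Γ x) t) • nuField Γ x‖ ^ 2 - _ ≤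
    verticalSpeed β (divergence (nuField Γ) x) (slope Γ x) t
  rw [norm_smul, h.norm_nuField hx, mul_one, Real.norm_eq_abs, sq_abs]
  linarith

/-- At a boundary point below the level `1` the horizontal component is continuous along the
closed exterior cylinder: nearby, `|∇Γ| / Γ` is so large that the speed is `2 β t`. -/
lemma continuousWithinAt_calibration_fst (h : IsExteriorPotential Ω Γ) (hβ : 0 < β)
    (hg : ContinuousOn g Ωᶜ) (hgU : ∀ x ∈ (closure Ω)ᶜ, g x = ∇ Γ x) (hg0 : ∀ x ∉ Ω, g x ≠ 0)
    {p : SpT n} (hpΩ : p.fst ∉ Ω) (hp : p.fst ∈ frontier Ω) (hpt : p.snd ∈ Icc (0 : ℝ) 1)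
    (ht : p.snd < 1) :
    ContinuousWithinAt (fun q => (calibration β Ω Γ g q).fst)
      {p | p.fst ∉ Ω ∧ p.snd ∈ Icc (0 : ℝ) 1} p := by
  set A : Set (SpT n) := {p | p.fst ∉ Ω ∧ p.snd ∈ Icc (0 : ℝ) 1} with hA
  have hmaps : MapsTo (fun p : SpT n => p.fst) A Ωᶜ := fun p hp => hp.1
  have hf := (continuous_fst_SpT (n := n)).continuousWithinAt (s := A) (x := p)
  have hs := (continuous_snd_SpT (n := n)).continuousWithinAt (s := A) (x := p)
  have hgA : ContinuousWithinAt (fun q : SpT n => g q.fst) A p :=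
    (hg p.fst hpΩ).comp hf hmaps
  have hΓA : ContinuousWithinAt (fun q : SpT n => Γ q.fst) A p :=
    (h.continuousOn p.fst hpΩ).comp hf hmaps
  have hN : ContinuousWithinAt
      (fun q : SpT n => (-(2 * β * q.snd)) • ‖g q.fst‖⁻¹ • g q.fst) A p :=
    (continuousWithinAt_const.mul hs).neg.smul
      ((hgA.norm.inv₀ (norm_ne_zero_iff.2 (hg0 _ hpΩ))).smul hgA)
  have hltp : β * Γ p.fst < (1 - p.snd) * ‖g p.fst‖ := by
    rw [h.eq_zero _ hp, mul_zero]
    exact mul_pos (by linarith) (norm_pos_iff.2 (hg0 _ hpΩ))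
  have hlt : ∀ᶠ q in 𝓝[A] p, β * Γ q.fst < (1 - q.snd) * ‖g q.fst‖ :=
    (continuousWithinAt_const.mul hΓA).eventually_lt
      ((continuousWithinAt_const.sub hs).mul hgA.norm) hltp
  have hval : ∀ q ∈ A, β * Γ q.fst < (1 - q.snd) * ‖g q.fst‖ →
      (calibration β Ω Γ g q).fst = (-(2 * β * q.snd)) • ‖g q.fst‖⁻¹ • g q.fst := by
    intro q hq hqlt
    by_cases hqc : q.fst ∈ closure Ω
    · exact congrArg WithLp.fst (calibration_pt_of_mem_closure hq.2 hqc)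
    · have h1 : (β + slope Γ q.fst) * q.snd ≤ slope Γ q.fst := by
        have hΓ := h.pos _ hqc
        have h2 : slope Γ q.fst * Γ q.fst = ‖g q.fst‖ := by
          rw [slope, div_mul_cancel₀ _ hΓ.ne', hgU _ hqc]
        rw [← h2, ← mul_assoc] at hqlt
        have h3 := lt_of_mul_lt_mul_right hqlt hΓ.le
        nlinarith [hq.2.2]
      refine (congrArg WithLp.fst (calibration_pt_of_notMem_closure hq.2 hqc)).trans ?_
      rw [excess_of_le h1, hgU _ hqc]
      simp [pt, nuField]
  refine hN.congr_of_eventuallyEq ?_ (hval p ⟨hpΩ, hpt⟩ hltp)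
  filter_upwards [hlt, self_mem_nhdsWithin] with q hq hqA using hval q hqA hq

lemma isApproxRegularOn_calibration (hΩ : IsC2Domain Ω) (h : IsExteriorPotential Ω Γ)
    (hβ : 0 < β) (hg : ContinuousOn g Ωᶜ) (hgU : ∀ x ∈ (closure Ω)ᶜ, g x = ∇ Γ x)
    (hg0 : ∀ x ∉ Ω, g x ≠ 0) :
    IsApproxRegularOn (calibration β Ω Γ g) {p | p.fst ∉ Ω ∧ p.snd ∈ Icc (0 : ℝ) 1} := by
  intro M _
  have hrank : (Module.finrank ℝ (SpT n) : ℝ) - 1 = n := by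
    rw [(WithLp.linearEquiv 2 ℝ (Sp n × ℝ)).finrank_eq]
    simp
  rw [hrank]
  have hnull := hΩ.hausdorffMeasure_frontier
  have hn : (0 : ℝ) ≤ n := n.cast_nonneg
  -- the two exceptional sets: the top rim of the boundary cylinder, and the points of the
  -- cylinder where the normal of `M` is not horizontal
  have hbad1 : Measure.hausdorffMeasure (n : ℝ) {p : SpT n | p.fst ∈ frontier Ω ∧ p.snd = 1} = 0 :=
    hausdorffMeasure_eq_zero_of_lipschitz hn hnull (fun p hp => hp.1) 0 fun p hp y hy => by
      simp [hp.2, hy.2]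
  have hbad2 := hausdorffMeasure_nonhorizontal_eq_zero M hn hnull
  filter_upwards [measure_eq_zero_iff_ae_notMem.1 hbad1, measure_eq_zero_iff_ae_notMem.1 hbad2]
    with p hp1 hp2 ⟨hpM, hpΩ, hpt⟩ ν hν
  refine approxTendsto_of_continuousWithinAt ?_
  by_cases hpc : p.fst ∈ closure Ω
  · have hpf : p.fst ∈ frontier Ω := by rw [hΩ.1.frontier_eq]; exact ⟨hpc, hpΩ⟩
    have hlt : p.snd < 1 := hpt.2.lt_of_ne fun h1 => hp1 ⟨hpf, h1⟩
    have hν0 : ν.snd = 0 := by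
      by_contra hne
      exact hp2 ⟨hpM, hpf, ν, hν, hne⟩
    simp only [inner_SpT, hν0, mul_zero, add_zero]
    exact (continuousWithinAt_calibration_fst h hβ hg hgU hg0 hpΩ hpf hpt hlt).inner
      continuousWithinAt_const
  · have hV : IsOpen {p : SpT n | p.fst ∉ closure Ω} :=
      (isOpen_compl_closure Ω).preimage continuous_fst_SpT
    have hc := ((continuousOn_exterior_field h hβ).continuousAt
      (hV.mem_nhds hpc)).continuousWithinAt (s := {p | p.fst ∉ Ω ∧ p.snd ∈ Icc (0 : ℝ) 1})
    refine ContinuousWithinAt.inner (hc.congr_of_eventuallyEq ?_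
      (calibration_pt_of_notMem_closure hpt hpc)) continuousWithinAt_const
    filter_upwards [self_mem_nhdsWithin, mem_nhdsWithin_of_mem_nhds (hV.mem_nhds hpc)]
      with q hqA hqV using calibration_pt_of_notMem_closure hqA.2 hqV

/-- On the boundary the direction of the extended gradient is the outward unit normal. -/
lemma IsDefiningFunctionAt.normalize_eq {x : Sp n} {ρ : Sp n → ℝ}
    (hρ : IsDefiningFunctionAt Ω x ρ)
    (hgx : ∀ ν : Sp n, IsOutwardUnitNormal Ω x ν → ∃ t : ℝ, 0 < t ∧ g x = t • ν) :
    g x ≠ 0 ∧ ‖g x‖⁻¹ • g x = ‖∇ ρ x‖⁻¹ • ∇ ρ x := by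
  have hne := norm_pos_iff.2 hρ.gradient_ne_zero
  obtain ⟨t, ht, heq⟩ := hgx _ ⟨ρ, hρ, rfl⟩
  have h1 : ‖‖∇ ρ x‖⁻¹ • ∇ ρ x‖ = 1 := by
    rw [norm_smul, norm_inv, norm_norm, inv_mul_cancel₀ hne.ne']
  have h2 : ‖g x‖ = t := by rw [heq, norm_smul, h1, mul_one, Real.norm_of_nonneg ht.le]
  refine ⟨norm_pos_iff.1 (h2 ▸ ht), ?_⟩
  rw [h2, heq, smul_smul, inv_mul_cancel₀ ht.ne', one_smul]

end FieldBounds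

/-! ### The characteristic function as a competitor -/

section Competitor

variable {n : ℕ} {Ω : Set (Sp n)} {Γ : Sp n → ℝ} {g : Sp n → Sp n}

lemma hasApproxGradientAt_indicator_one {x : Sp n} (hx : x ∉ closure Ω) :
    HasApproxGradientAt (Ω.indicator fun _ => (1 : ℝ)) 0 x := by
  obtain ⟨δ, hδ, hball⟩ := Metric.isOpen_iff.1 (isOpen_compl_closure Ω) x hx
  refine tendsto_const_nhds.congr' ?_
  filter_upwards [Ioo_mem_nhdsGT hδ] with r hr
  have hzero : ∀ y ∈ Metric.ball x r, Ω.indicator (fun _ => (1 : ℝ)) y = 0 := fun y hy =>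
    indicator_of_notMem (fun h' => hball (Metric.ball_subset_ball hr.2.le hy)
      (subset_closure h')) _
  rw [setAverage_congr_fun (g := fun _ => 0) Metric.isOpen_ball.measurableSet
    (Eventually.of_forall fun y hy => by
      rw [hzero y hy, hzero x (Metric.mem_ball_self hr.1)]; simp)]
  simp

lemma isSBV_indicator_one (hΩ : IsC2Domain Ω) (hb : Bornology.IsBounded Ω)
    (h : IsExteriorPotential Ω Γ) (hg : ContinuousOn g Ωᶜ)
    (hgU : ∀ x ∈ (closure Ω)ᶜ, g x = ∇ Γ x) (hg0 : ∀ x ∉ Ω, g x ≠ 0) :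
    IsSBV (Ω.indicator fun _ => (1 : ℝ)) := by
  obtain ⟨m, σ, hm, hm0, hσ, hdiv⟩ :=
    exists_boundary_measure hΩ.1 hb hΩ.volume_frontier h hg hgU hg0
  have hK : IsCompact (frontier Ω) := hb.isCompact_closure.of_isClosed_subset isClosed_frontier
    frontier_subset_closure
  have hmr : m.restrict (frontier Ω) = m :=
    Measure.restrict_eq_self_of_ae_mem (measure_eq_zero_iff_ae_notMem.1 hm0 |>.mono fun x hx =>
      not_not.1 hx)
  have hint {F : Type} [NormedAddCommGroup F] {f : Sp n → F} (hf : Continuous f) :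
      Integrable f m := by
    rw [← hmr]
    exact hf.continuousOn.integrableOn_compact hK
  refine ⟨?_, fun _ => 0, m, σ, integrable_zero _ _ _, hm, hint hσ, ?_, ?_⟩
  · exact (integrable_indicator_iff hΩ.1.measurableSet).2
      (integrableOn_const hb.measure_lt_top.ne)
  · refine measure_mono_null (compl_subset_compl.2 fun x hx => ?_) hm0
    obtain ⟨ρ, hρ⟩ := hΩ.2 x hx
    exact ⟨_, _, _, hρ.isJump hΩ.1 hx⟩
  · intro ψ hψ hψc
    have hψ1 : ContDiff ℝ 1 ψ := hψ.of_le (WithTop.coe_le_coe.2 le_top)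
    have hgrad : Continuous (∇ ψ) := (InnerProductSpace.toDual ℝ (Sp n)).symm.continuous.comp
      (hψ1.continuous_fderiv (by norm_num))
    have hgradc : HasCompactSupport (∇ ψ) := (hψc.fderiv ℝ).comp_left (map_zero _)
    have hi1 : Integrable (∇ ψ) (volume.restrict Ω) :=
      (hgrad.integrable_of_hasCompactSupport hgradc).restrict
    have hi2 : Integrable (fun x => ψ x • σ x) m := hint (hψ.continuous.smul hσ)
    have hind : (fun x => Ω.indicator (fun _ => (1 : ℝ)) x • ∇ ψ x) = Ω.indicator (∇ ψ) := by
      ext1 x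
      by_cases hx : x ∈ Ω <;> simp [hx]
    rw [hind, integral_indicator hΩ.1.measurableSet]
    simp only [smul_zero, integral_zero, zero_add]
    refine ext_inner_left ℝ fun v => ?_
    rw [inner_neg_right, ← integral_inner hi1, ← integral_inner hi2]
    have := hdiv ψ hψ1 hψc v
    simp only [real_inner_comm _ v, inner_gradient_left, real_inner_smul_left] at this ⊢
    exact this

/-- The characteristic function of `Ω` is calibrated by `calibration β Ω Γ g`, with `g` the
continuous extension of `∇Γ` up to the boundary. -/
theorem isCalibrated_indicator_one {β γ : ℝ} (hβ : 0 < β) (hΩ_bdd : Bornology.IsBounded Ω)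
    (hΩ_C2 : IsC2Domain Ω) (hΓ : IsExteriorPotential Ω Γ)
    (hdiv : ∃ C : ℝ, ∀ x ∈ (closure Ω)ᶜ, |divergence (nuField Γ) x| ≤ C)
    (hcond : ∀ x ∈ (closure Ω)ᶜ,
      (β ^ 2 - β * divergence (nuField Γ) x) * deltaFun β Γ x ^ 2 ≤ γ ^ 2) :
    IsCalibrated β γ Ω (Ω.indicator fun _ => (1 : ℝ)) := by
  obtain ⟨g, hg, hgU, hgf⟩ := hΓ.gradient_extends
  obtain ⟨C, hC⟩ := hdiv
  have hΩ := hΩ_C2.1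
  have hg0 : ∀ x ∉ Ω, g x ≠ 0 := by
    intro x hx
    by_cases hxc : x ∈ closure Ω
    · have hxf : x ∈ frontier Ω := by rw [hΩ.frontier_eq]; exact ⟨hxc, hx⟩
      obtain ⟨ρ, hρ⟩ := hΩ_C2.2 x hxf
      exact (hρ.normalize_eq (hgf x hxf)).1
    · rw [hgU x hxc]
      exact hΓ.gradient_ne_zero x hxc
  refine ⟨⟨isSBV_indicator_one hΩ_C2 hΩ_bdd hΓ hg hgU hg0, ?_, ?_, ?_⟩, calibration β Ω Γ g, ?_⟩
  · exact Eventually.of_forall fun x hx => indicator_of_mem hx _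
  · refine Eventually.of_forall fun x => ?_
    unfold indicator
    split_ifs <;> simp
  · exact ⟨closure Ω, hΩ_bdd.isCompact_closure, Eventually.of_forall fun x hx =>
      indicator_of_notMem (fun h' => hx (subset_closure h')) _⟩
  refine ⟨measurable_calibration hΓ hβ hg hg0, ?_, ?_, isDivergenceFreeOn_calibration hβ hΓ,
    ?_, ?_, ?_, ?_⟩
  · exact ⟨_, fun x _ t ht => calibration_bounded hΓ hβ hgU (le_max_right C 0)
      (fun y hy => (hC y hy).trans (le_max_left C 0)) x ht⟩
  · exact isApproxRegularOn_calibration hΩ_C2 hΓ hβ hg hgU hg0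
  · exact Eventually.of_forall fun x hx t ht => calibration_lower_bound hΓ hβ hcond hx ht
  · exact Eventually.of_forall fun x _ r s hrs => calibration_flux_bound hΓ hβ hgU x hrs
  · refine Eventually.of_forall fun x hx => ⟨0, hasApproxGradientAt_indicator_one hx, ?_⟩
    have hu : Ω.indicator (fun _ => (1 : ℝ)) x = 0 :=
      indicator_of_notMem (fun h' => hx (subset_closure h')) _
    have hle : (β + slope Γ x) * 0 ≤ slope Γ x := by
      simpa using (hΓ.slope_pos hx).le
    rw [hu, calibration_pt_of_notMem_closure ⟨le_rfl, zero_le_one⟩ hx, excess_of_le hle,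
      verticalSpeed_of_le hle]
    simp [pt, volumeTerm]
  · refine Eventually.of_forall fun x a b ν hj => ?_
    have hxf := mem_frontier_of_isJump hΩ hj
    obtain ⟨ρ, hρ⟩ := hΩ_C2.2 x hxf
    obtain ⟨rfl, rfl, rfl⟩ := hρ.eq_of_isJump hΩ hxf hj
    rw [integral_calibration_fst_of_mem_closure (frontier_subset_closure hxf),
      (hρ.normalize_eq (hgf x hxf)).2]
    simp

end Competitor

end

end ThermalInsulation

theorem theorem3p2 (n : ℕ) (hn : 1 ≤ n) (β γ : ℝ) (hβ : 0 < β) (hγ : 0 < γ)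
    (Ω : Set (ThermalInsulation.Sp n)) (hΩ_ne : Ω.Nonempty) (hΩ_bdd : Bornology.IsBounded Ω)
    (hΩ_C2 : ThermalInsulation.IsC2Domain Ω) (hΩ_star : ∃ x₀ ∈ Ω, StarConvex ℝ x₀ Ω)
    (Γ : ThermalInsulation.Sp n → ℝ) (hΓ : ThermalInsulation.IsExteriorPotential Ω Γ)
    (hdiv : ∃ C : ℝ, ∀ x ∈ (closure Ω)ᶜ,
      |ThermalInsulation.divergence (ThermalInsulation.nuField Γ) x| ≤ C)
    (hcond : ∀ x ∈ (closure Ω)ᶜ,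
      (β ^ 2 - β * ThermalInsulation.divergence (ThermalInsulation.nuField Γ) x) *
        ThermalInsulation.deltaFun β Γ x ^ 2 ≤ γ ^ 2) :
    ThermalInsulation.IsCalibrated β γ Ω (Ω.indicator (fun _ => (1 : ℝ))) := by
  exact ThermalInsulation.isCalibrated_indicator_one hβ hΩ_bdd hΩ_C2 hΓ hdiv hcond
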